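/- Let $D=[0,1]$, $p\in[1,\infty]$, and let $p^*$ be the conjugate exponent, $1/p+1/p^*=1$ (with $1/\infty=0$). For $s\in\mathbb{N}$ write $[s]=\{1,\dots,s\}$; for $u\subseteq[s]$ let $u^c=[s]\setminus u$, let $D^u$ be the unit cube in the coordinates of $u$, let $[x_u;t_{u^c}]$ be the point whose coordinates are $x_j$ for $j\in u$ and $t_j$ for $j\notin u$, and let $f^{(u)}=\prod_{j\in u}\frac{\partial}{\partial x_j}f$ in the weak sense ($f^{(u)}([\,\cdot_u;0_{u^c}])$ being the weak derivative of $x_u\mapsto f([x_u;0_{u^c}])$). Given weights $\gamma_u\ge 0$ ($u\subseteq[s]$), let $U=\{u\subseteq[s]:\gamma_u>0\}$. The anchored space $F_{s,p,\gamma}$ consists of all functions on $D^s$ of the form $$f(x)=\sum_{u\in U}\int_{D^u}h_u(t)\prod_{j\in u}\mathbf 1_{[0,x_j)}(t_j)\,dt,\qquad h_u\in L_p(D^u),$$ with the norm $\|f\|_{F}=\Big(\sum_{u\in U}\gamma_u^{-p}\,\big\|f^{(u)}([\,\cdot_u;0_{u^c}])\big\|_{L_p(D^u)}^p\Big)^{1/p}$,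 and the ANOVA space $H_{s,p,\gamma}$ consists of all functions on $D^s$ of the form $$f(x)=\sum_{u\in U}\int_{D^u}g_u(t)\prod_{j\in u}\big(\mathbf 1_{[0,x_j)}(t_j)-(1-t_j)\big)\,dt,\qquad g_u\in L_p(D^u),$$ with the norm $\|f\|_{H}=\Big(\sum_{u\in U}\gamma_u^{-p}\,\Big\|\int_{D^{u^c}}f^{(u)}([\,\cdot_u;t_{u^c}])\,dt_{u^c}\Big\|_{L_p(D^u)}^p\Big)^{1/p}$. For $p=\infty$ the $\ell_p$-sums are replaced by maxima, and for $u=\emptyset$ the integrals over $D^u$ are constants. Let $\omega>0$ and let $q\ge 0$ be an integer. Consider the finite diameter weights $\gamma_u=\omega^{|u|}$ if $\operatorname{diam}(u)\le q$ and $\gamma_u=0$ otherwise, where $\operatorname{diam}(u)=\max_{i,j\in u}|i-j|$ and $\operatorname{diam}(\emptyset)=0$. Then the embedding $\imath: F_{s,p,\gamma}\hookrightarrow H_{s,p,\gamma}$, $\imath(f)=f$, is well defined and $$\|\imath\|_{F_{s,p,\gamma}\hookrightarrow H_{s,p,\gamma}}=\Theta\big((s-q)^{1/p^*}\big),$$ that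 is, there are constants $0<c\le C<\infty$ depending only on $\omega$, $q$ and $p$ such that for all integers $s>q$ $$c\,(s-q)^{1/p^*}\le\|\imath\|_{F_{s,p,\gamma}\hookrightarrow H_{s,p,\gamma}}\le C\,(s-q)^{1/p^*}.$$ -/

import Mathlib

open MeasureTheory
open scoped ENNReal

noncomputable section

namespace AnchoredANOVA

/-- The closed unit cube `D^ι = [0,1]^ι`. -/
def cube (ι : Type*) : Set (ι → ℝ) := Set.univ.pi fun _ => Set.Icc (0 : ℝ) 1

/-- The open unit cube `(0,1)^ι`. -/
def openCube (ι : Type*) : Set (ι → ℝ) := Set.univ.pi fun _ => Set.Ioo (0 : ℝ) 1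

/-- Lebesgue measure on the unit cube. -/
def cubeMeasure (ι : Type*) [Fintype ι] : Measure (ι → ℝ) := volume.restrict (cube ι)

/-- The (classical) partial derivative `∂φ/∂x_j`. -/
def partialDeriv {ι : Type*} [Fintype ι] [DecidableEq ι] (j : ι) (φ : (ι → ℝ) → ℝ) :
    (ι → ℝ) → ℝ :=
  fun x => fderiv ℝ φ x (Pi.single j 1)

/-- The (classical) mixed partial derivative `∏_{j ∈ v} ∂/∂x_j φ`, one derivative for each
coordinate in `v`. It is used for smooth `φ` only, where the order is irrelevant. -/
def mixedPartial {ι : Type*} [Fintype ι] [LinearOrder ι] (v : Finset ι) (φ : (ι → ℝ) → ℝ) :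
    (ι → ℝ) → ℝ :=
  (v.sort (· ≤ ·)).foldr partialDeriv φ

/-- `G` is the weak (Sobolev) mixed derivative `g^{(v)} = ∏_{j ∈ v} ∂/∂x_j g` of the function `g`
on the unit cube. -/
structure IsMixedDeriv {ι : Type*} [Fintype ι] [LinearOrder ι] (v : Finset ι)
    (g G : (ι → ℝ) → ℝ) : Prop where
  integrable_fun : Integrable g (cubeMeasure ι)
  integrable_deriv : Integrable G (cubeMeasure ι)
  integral_eq : ∀ φ : (ι → ℝ) → ℝ, ContDiff ℝ (⊤ : ℕ∞) φ → HasCompactSupport φ →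
    tsupport φ ⊆ openCube ι →
    ∫ x, g x * mixedPartial v φ x ∂(cubeMeasure ι) =
      (-1) ^ v.card * ∫ x, G x * φ x ∂(cubeMeasure ι)

/-- The point `[y_u; t_{u^c}]`: coordinates in `u` are taken from `y`, the others from `t`. -/
def glue {s : ℕ} (u : Finset (Fin s)) (y : ↥u → ℝ) (t : {j : Fin s // j ∉ u} → ℝ) : Fin s → ℝ :=
  fun j => if h : j ∈ u then y ⟨j, h⟩ else t ⟨j, h⟩

/-- `T_u(h)(x) = ∫_{D^u} h(t) ∏_{j ∈ u} 1_{[0,x_j)}(t_j) dt`. For `u = ∅` this is a constant. -/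
def anchoredTerm {s : ℕ} (u : Finset (Fin s)) (h : (↥u → ℝ) → ℝ) (x : Fin s → ℝ) : ℝ :=
  ∫ t, h t * ∏ j : ↥u, (Set.Ico (0 : ℝ) (x j)).indicator (fun _ => (1 : ℝ)) (t j)
    ∂(cubeMeasure ↥u)

/-- `∫_{D^u} g(t) ∏_{j ∈ u} (1_{[0,x_j)}(t_j) - (1 - t_j)) dt`. For `u = ∅` this is a constant. -/
def anovaTerm {s : ℕ} (u : Finset (Fin s)) (g : (↥u → ℝ) → ℝ) (x : Fin s → ℝ) : ℝ :=
  ∫ t, g t * ∏ j : ↥u, ((Set.Ico (0 : ℝ) (x j)).indicator (fun _ => (1 : ℝ)) (t j) - (1 - t j))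
    ∂(cubeMeasure ↥u)

/-- The sets `u` of coordinates with positive weight. -/
def activeSets {s : ℕ} (γ : Finset (Fin s) → ℝ) : Finset (Finset (Fin s)) :=
  {u | 0 < γ u}

/-- The functions on `[0,1]^s` belonging to the `γ`-weighted anchored space: the sums
`∑_{u : γ_u > 0} T_u(h_u)` with `h_u ∈ L_p(D^u)`. Values outside the cube are irrelevant. -/
def anchoredSpace (s : ℕ) (p : ℝ≥0∞) (γ : Finset (Fin s) → ℝ) : Set ((Fin s → ℝ) → ℝ) :=
  {f | ∃ h : ∀ u : Finset (Fin s), (↥u → ℝ) → ℝ,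
    (∀ u ∈ activeSets γ, MemLp (h u) p (cubeMeasure ↥u)) ∧
    ∀ x ∈ cube (Fin s), f x = ∑ u ∈ activeSets γ, anchoredTerm u (h u) x}

/-- The functions on `[0,1]^s` belonging to the `γ`-weighted ANOVA space. -/
def anovaSpace (s : ℕ) (p : ℝ≥0∞) (γ : Finset (Fin s) → ℝ) : Set ((Fin s → ℝ) → ℝ) :=
  {f | ∃ g : ∀ u : Finset (Fin s), (↥u → ℝ) → ℝ,
    (∀ u ∈ activeSets γ, MemLp (g u) p (cubeMeasure ↥u)) ∧
    ∀ x ∈ cube (Fin s), f x = ∑ u ∈ activeSets γ, anovaTerm u (g u) x}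

/-- The `ℓ_p` norm of a finite family, the maximum for `p = ∞`. -/
def lpSum {α : Type*} (p : ℝ≥0∞) (S : Finset α) (a : α → ℝ≥0∞) : ℝ≥0∞ :=
  if p = ∞ then S.sup a else (∑ u ∈ S, a u ^ p.toReal) ^ (1 / p.toReal)

/-- `‖f^{(u)}([·_u; 0_{u^c}])‖_{L_p(D^u)}`. The weak derivative is unique up to null sets, so that
the infimum runs over a single value; it is `∞` if there is no weak derivative. -/
def anchoredPart {s : ℕ} (p : ℝ≥0∞) (u : Finset (Fin s)) (f : (Fin s → ℝ) → ℝ) : ℝ≥0∞ :=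
  ⨅ (G : (↥u → ℝ) → ℝ)
    (_ : IsMixedDeriv (Finset.univ : Finset ↥u) (fun y => f (glue u y fun _ => 0)) G),
    eLpNorm G p (cubeMeasure ↥u)

/-- `‖∫_{D^{u^c}} f^{(u)}([·_u; t_{u^c}]) dt‖_{L_p(D^u)}`. The weak derivative is unique up to null
sets, so that the infimum runs over a single value; it is `∞` if there is no weak derivative. -/
def anovaPart {s : ℕ} (p : ℝ≥0∞) (u : Finset (Fin s)) (f : (Fin s → ℝ) → ℝ) : ℝ≥0∞ :=
  ⨅ (G : (Fin s → ℝ) → ℝ) (_ : IsMixedDeriv u f G),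
    eLpNorm (fun y : ↥u → ℝ => ∫ t, G (glue u y t) ∂(cubeMeasure {j : Fin s // j ∉ u}))
      p (cubeMeasure ↥u)

/-- The norm of the anchored space,
`(∑_u γ_u^{-p} ‖f^{(u)}([·_u; 0_{u^c}])‖_{L_p}^p)^{1/p}`. -/
def anchoredNorm {s : ℕ} (p : ℝ≥0∞) (γ : Finset (Fin s) → ℝ) (f : (Fin s → ℝ) → ℝ) : ℝ≥0∞ :=
  lpSum p (activeSets γ) fun u => ENNReal.ofReal (γ u)⁻¹ * anchoredPart p u f

/-- The norm of the ANOVA space,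
`(∑_u γ_u^{-p} ‖∫_{D^{u^c}} f^{(u)}([·_u; t_{u^c}]) dt‖_{L_p}^p)^{1/p}`. -/
def anovaNorm {s : ℕ} (p : ℝ≥0∞) (γ : Finset (Fin s) → ℝ) (f : (Fin s → ℝ) → ℝ) : ℝ≥0∞ :=
  lpSum p (activeSets γ) fun u => ENNReal.ofReal (γ u)⁻¹ * anovaPart p u f

/-- The operator norm of the embedding `f ↦ f` of the anchored space into the ANOVA space
(`∞` if the embedding is not defined or not bounded). -/
def embeddingNorm (s : ℕ) (p : ℝ≥0∞) (γ : Finset (Fin s) → ℝ) : ℝ≥0∞ :=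
  sInf {C : ℝ≥0∞ | ∀ f ∈ anchoredSpace s p γ,
    f ∈ anovaSpace s p γ ∧ anovaNorm p γ f ≤ C * anchoredNorm p γ f}

/-- `diam(u) = max_{i,j ∈ u} |i - j|`, with `diam(∅) = 0`. -/
def diam {s : ℕ} (u : Finset (Fin s)) : ℕ :=
  u.sup fun i => u.sup fun j => ((i : ℤ) - (j : ℤ)).natAbs

/-- Finite diameter weights. -/
def finiteDiameterWeight (s : ℕ) (ω : ℝ) (q : ℕ) (u : Finset (Fin s)) : ℝ :=
  if diam u ≤ q then ω ^ u.card else 0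

end AnchoredANOVA

end

/-! Write `f = ∑_w T_w(h_w)` over the active sets. At the anchor 0 every term with `w ⊄ u` vanishes,
and the full mixed derivative in the coordinates of `u` kills every `w ⊊ u`. So the anchored part at
`u` is exactly `‖h_u‖_p` (`IsAnchoredRep.anchoredPart_eq`).

For the ANOVA parts, `T_w(h_w)` has zero mixed derivative in `v` unless `v ⊆ w`. In that case the
derivative substitutes `x_v` for `t_v` and integrates the remaining kernels. These lie in [0,1] and
the cube has mass one, so Jensen bounds the averaged part at `v` by `∑_{w ⊇ v} ‖h_w‖_p`
(`IsAnchoredRep.anovaPart_le`). Membership in the ANOVA space follows by expanding `1_{[0,x)}(t) =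
(1_{[0,x)}(t) - (1 - t)) + (1 - t)` in each coordinate (`IsAnchoredRep.mem_anova`).

Upper bound: an active set has at most `q + 1` elements, so passing from `w` to `v ⊆ w` costs a
bounded factor in the weights, and each `w` has at most `2^(q+1)` subsets. Only the number of `w ⊇
v` can grow with `s` (for `v = ∅` it is the number `N` of all active sets). Hölder turns it into
`N^{1/p*}` (`lpSum_le_of_le_sum`), and `N = O(s - q)`.

Lower bound: `f(x) = ∑ x_i` has anchored norm at most `ω⁻¹ s^{1/p}`, while its mean `s/2` is a lower
bound for its ANOVA norm (`le_embeddingNorm`). -/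

namespace AnchoredANOVA

/-! ### Uniform measures on cubes and rearrangements of coordinates -/

section Measure

variable {ι α β : Type*} [Fintype ι] [Fintype α] [Fintype β]

theorem cubeMeasure_eq_pi (ι : Type*) [Fintype ι] :
    cubeMeasure ι = Measure.pi fun _ : ι => (volume : Measure ℝ).restrict (Set.Icc 0 1) := by
  rw [cubeMeasure, cube, volume_pi, Measure.restrict_pi_pi]

instance isProbabilityMeasure_restrict_unitInterval :
    IsProbabilityMeasure ((volume : Measure ℝ).restrict (Set.Icc 0 1)) :=
  ⟨by simp⟩

instance isProbabilityMeasure_cubeMeasure : IsProbabilityMeasure (cubeMeasure ι) := by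
  rw [cubeMeasure_eq_pi]; infer_instance

theorem measurableSet_cube : MeasurableSet (cube ι) :=
  MeasurableSet.univ_pi fun _ => measurableSet_Icc

theorem isOpen_openCube : IsOpen (openCube ι) :=
  isOpen_set_pi Set.finite_univ fun _ _ => isOpen_Ioo

theorem ae_mem_cube : ∀ᵐ x ∂cubeMeasure ι, x ∈ cube ι :=
  ae_restrict_mem measurableSet_cube

theorem ae_mem_openCube : ∀ᵐ x ∂cubeMeasure ι, x ∈ openCube ι := by
  have h : ∀ i : ι, ∀ᵐ x ∂cubeMeasure ι, x i ∈ Set.Ioo (0 : ℝ) 1 := by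
    intro i
    rw [cubeMeasure_eq_pi]
    refine (measurePreserving_eval _ i).quasiMeasurePreserving.ae ?_
    rw [← restrict_Ioo_eq_restrict_Icc]
    exact ae_restrict_mem measurableSet_Ioo
  filter_upwards [ae_all_iff.2 h] with x hx i _ using hx i

/-- Choosing coordinates along an injection preserves the uniform measure on cubes. -/
theorem measurePreserving_comp_injective {e : α → β} (he : Function.Injective e) :
    MeasurePreserving (fun t : β → ℝ => t ∘ e) (cubeMeasure β) (cubeMeasure α) := by
  classical
  have hm : Measurable fun t : β → ℝ => t ∘ e :=
    measurable_pi_lambda _ fun i => measurable_pi_apply _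
  refine ⟨hm, ?_⟩
  rw [cubeMeasure_eq_pi α, cubeMeasure_eq_pi β]
  refine (Measure.pi_eq fun s hs => ?_).symm
  rw [Measure.map_apply hm (MeasurableSet.univ_pi hs)]
  have hpre : (fun t : β → ℝ => t ∘ e) ⁻¹' Set.univ.pi s =
      Set.univ.pi fun b => {r | ∀ a, e a = b → r ∈ s a} := by
    ext t
    simp only [Set.mem_preimage, Set.mem_univ_pi, Function.comp, Set.mem_ofPred_eq]
    exact ⟨fun h b a hab => hab ▸ h a, fun h a => h _ a rfl⟩
  rw [hpre, Measure.pi_pi]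
  rw [← Finset.prod_subset (Finset.subset_univ (Finset.univ.map ⟨e, he⟩)), Finset.prod_map]
  · refine Finset.prod_congr rfl fun a _ => ?_
    congr 1
    ext r
    simp only [Function.Embedding.coeFn_mk, Set.mem_ofPred_eq]
    exact ⟨fun h => h a rfl, fun h a' ha' => he ha' ▸ h⟩
  -- A side over a coordinate outside the range of `e` is unconstrained, hence of mass one.
  · intro b _ hb
    have : {r : ℝ | ∀ a, e a = b → r ∈ s a} = Set.univ := by
      ext r
      simp only [Set.mem_ofPred_eq, Set.mem_univ, iff_true]
      rintro a rfl
      simp at hb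
    rw [this, measure_univ]

theorem measurePreserving_sumElim :
    MeasurePreserving (fun z : (α → ℝ) × (β → ℝ) => Sum.elim z.1 z.2)
      ((cubeMeasure α).prod (cubeMeasure β)) (cubeMeasure (α ⊕ β)) := by
  have := measurePreserving_sumPiEquivProdPi_symm (X := fun _ : α ⊕ β => ℝ)
    (fun _ => (volume : Measure ℝ).restrict (Set.Icc 0 1))
  rw [cubeMeasure_eq_pi, cubeMeasure_eq_pi, cubeMeasure_eq_pi]
  convert this using 1
  ext z i
  cases i <;> rfl

theorem measurePreserving_sumElim_comp {e : ι → α ⊕ β} (he : Function.Injective e) :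
    MeasurePreserving (fun z : (α → ℝ) × (β → ℝ) => Sum.elim z.1 z.2 ∘ e)
      ((cubeMeasure α).prod (cubeMeasure β)) (cubeMeasure ι) :=
  (measurePreserving_comp_injective he).comp measurePreserving_sumElim

variable [DecidableEq ι]

theorem measurePreserving_piecewise (v : Finset ι) :
    MeasurePreserving (fun z : (ι → ℝ) × (ι → ℝ) => v.piecewise z.1 z.2)
      ((cubeMeasure ι).prod (cubeMeasure ι)) (cubeMeasure ι) := by
  have he : Function.Injective fun i : ι => if i ∈ v then Sum.inl i else (Sum.inr i : ι ⊕ ι) := by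
    intro i j h
    by_cases hi : i ∈ v <;> by_cases hj : j ∈ v <;> simp_all
  convert measurePreserving_sumElim_comp he using 1
  ext z i
  by_cases hi : i ∈ v <;> simp [hi]

/-- Exchanging the coordinates in `v` between two independent points. -/
theorem measurePreserving_exchange (v : Finset ι) :
    MeasurePreserving
      (fun z : (ι → ℝ) × (ι → ℝ) => (v.piecewise z.1 z.2, v.piecewise z.2 z.1))
      ((cubeMeasure ι).prod (cubeMeasure ι)) ((cubeMeasure ι).prod (cubeMeasure ι)) := by
  let e : ι ⊕ ι → ι ⊕ ι := Sum.elim (fun i => if i ∈ v then Sum.inl i else Sum.inr i)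
    (fun i => if i ∈ v then Sum.inr i else Sum.inl i)
  have he : Function.Injective e := by
    rintro (i | i) (j | j) h <;> by_cases hi : i ∈ v <;> by_cases hj : j ∈ v <;>
      simp_all [e]
  have h1 := (measurePreserving_comp_injective he).comp (measurePreserving_sumElim (α := ι) (β := ι))
  have h2 := measurePreserving_sumPiEquivProdPi (X := fun _ : ι ⊕ ι => ℝ)
    (fun _ => (volume : Measure ℝ).restrict (Set.Icc 0 1))
  rw [← cubeMeasure_eq_pi, ← cubeMeasure_eq_pi] at h2
  convert h2.comp h1 using 1
  ext z i
  · by_cases hi : i ∈ v <;> simp [hi, e, MeasurableEquiv.sumPiEquivProdPi, Equiv.sumPiEquivProdPi]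
  · by_cases hi : i ∈ v <;> simp [hi, e, MeasurableEquiv.sumPiEquivProdPi, Equiv.sumPiEquivProdPi]

theorem measurePreserving_glue {s : ℕ} (u : Finset (Fin s)) :
    MeasurePreserving (fun z : (↥u → ℝ) × ({j : Fin s // j ∉ u} → ℝ) => glue u z.1 z.2)
      ((cubeMeasure ↥u).prod (cubeMeasure {j : Fin s // j ∉ u})) (cubeMeasure (Fin s)) := by
  let e : Fin s → ↥u ⊕ {j : Fin s // j ∉ u} :=
    fun i => if h : i ∈ u then Sum.inl ⟨i, h⟩ else Sum.inr ⟨i, h⟩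
  have he : Function.Injective e := by
    intro i j h
    by_cases hi : i ∈ u <;> by_cases hj : j ∈ u <;> simp_all [e]
  convert measurePreserving_sumElim_comp he using 1
  ext z i
  by_cases hi : i ∈ u <;> simp [hi, e, glue]

end Measure

/-! ### Averaging over a probability space contracts the L_p norm -/

section Jensen

variable {X Y : Type*} [MeasurableSpace X] [MeasurableSpace Y] {μ : Measure X} {ν : Measure Y}

/-- On each slice the L_1 norm is at most the L_p norm because `ν` has mass one; Tonelli then
integrates the p-th powers over `x`. -/
theorem eLpNorm_lintegral_enorm_le [SFinite μ] [IsProbabilityMeasure ν] {p : ℝ≥0∞} (hp : 1 ≤ p)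
    {K : X × Y → ℝ} (hK : AEStronglyMeasurable K (μ.prod ν)) :
    eLpNorm (fun x => ∫⁻ y, ‖K (x, y)‖ₑ ∂ν) p μ ≤ eLpNorm K p (μ.prod ν) := by
  rcases eq_or_ne p ∞ with rfl | hp'
  · simp only [eLpNorm_exponent_top]
    have h := Measure.ae_ae_of_ae_prod (enorm_ae_le_eLpNormEssSup K (μ.prod ν))
    refine eLpNormEssSup_le_of_ae_enorm_bound ?_
    filter_upwards [h] with x hx
    rw [enorm_eq_self]
    calc ∫⁻ y, ‖K (x, y)‖ₑ ∂ν ≤ ∫⁻ _, eLpNormEssSup K (μ.prod ν) ∂ν := lintegral_mono_ae hx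
      _ = _ := by simp
  · have h0 : p ≠ 0 := (zero_lt_one.trans_le hp).ne'
    have hpr : 0 < p.toReal := ENNReal.toReal_pos h0 hp'
    rw [eLpNorm_eq_lintegral_rpow_enorm_toReal h0 hp', eLpNorm_eq_lintegral_rpow_enorm_toReal h0 hp']
    refine ENNReal.rpow_le_rpow ?_ (by positivity)
    rw [lintegral_prod _ (hK.enorm.pow_const _)]
    refine lintegral_mono_ae ?_
    filter_upwards [hK.prodMk_left] with x hx
    rw [enorm_eq_self]
    have := eLpNorm_le_eLpNorm_of_exponent_le hp hx
    rw [eLpNorm_one_eq_lintegral_enorm, eLpNorm_eq_lintegral_rpow_enorm_toReal h0 hp'] at this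
    calc _ ≤ ((∫⁻ y, ‖K (x, y)‖ₑ ^ p.toReal ∂ν) ^ (1 / p.toReal)) ^ p.toReal :=
          ENNReal.rpow_le_rpow this hpr.le
      _ = _ := by rw [← ENNReal.rpow_mul, one_div_mul_cancel hpr.ne', ENNReal.rpow_one]

theorem eLpNorm_integral_le [SFinite μ] [IsProbabilityMeasure ν] {p : ℝ≥0∞} (hp : 1 ≤ p)
    {K : X × Y → ℝ} (hK : AEStronglyMeasurable K (μ.prod ν)) :
    eLpNorm (fun x => ∫ y, K (x, y) ∂ν) p μ ≤ eLpNorm K p (μ.prod ν) := by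
  refine le_trans (eLpNorm_mono_enorm fun x => ?_) (eLpNorm_lintegral_enorm_le hp hK)
  rw [enorm_eq_self]
  exact enorm_integral_le_lintegral_enorm _

end Jensen

/-! ### Uniqueness of weak mixed derivatives -/

section Uniqueness

variable {ι : Type*} [Fintype ι] [LinearOrder ι]

/-- The fundamental lemma of the calculus of variations gives equality on the open cube, and the
boundary is null. Hence the infima in `anchoredPart` and `anovaPart` can be computed from any single
derivative. -/
theorem IsMixedDeriv.ae_eq {v : Finset ι} {g G G' : (ι → ℝ) → ℝ} (h : IsMixedDeriv v g G)
    (h' : IsMixedDeriv v g G') : G =ᵐ[cubeMeasure ι] G' := by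
  have hd : Integrable (fun x => G x - G' x) (cubeMeasure ι) :=
    h.integrable_deriv.sub h'.integrable_deriv
  have key := isOpen_openCube.ae_eq_zero_of_integral_contDiff_smul_eq_zero
    (hd.locallyIntegrable.locallyIntegrableOn (openCube ι)) fun φ hφ hc hs => by
      have e := (h.integral_eq φ hφ hc hs).symm.trans (h'.integral_eq φ hφ hc hs)
      have e := mul_left_cancel₀ (pow_ne_zero _ (by norm_num)) e
      obtain ⟨C, hC⟩ := hc.exists_bound_of_continuous hφ.continuous
      have hm := hφ.continuous.aestronglyMeasurable (μ := cubeMeasure ι)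
      have i1 := h.integrable_deriv.mul_bdd hm (Filter.Eventually.of_forall hC)
      have i2 := h'.integrable_deriv.mul_bdd hm (Filter.Eventually.of_forall hC)
      simp only [smul_eq_mul, mul_comm (φ _), sub_mul]
      rw [integral_sub i1 i2, e, sub_self]
  filter_upwards [key, ae_mem_openCube] with x hx hx'
  exact sub_eq_zero.1 (hx hx')

theorem IsMixedDeriv.congr {v : Finset ι} {f g G : (ι → ℝ) → ℝ} (h : IsMixedDeriv v g G)
    (hfg : ∀ x ∈ cube ι, f x = g x) : IsMixedDeriv v f G := by
  have hae : f =ᵐ[cubeMeasure ι] g := ae_mem_cube.mono hfg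
  refine ⟨h.integrable_fun.congr hae.symm, h.integrable_deriv, fun φ h1 h2 h3 => ?_⟩
  rw [← h.integral_eq φ h1 h2 h3]
  exact integral_congr_ae (hae.mono fun x hx => by simp only [hx])

end Uniqueness

/-! ### Test functions and integration by parts against product kernels -/

section TestFunction

variable {ι : Type*} [Fintype ι] [DecidableEq ι]

/-- Smooth functions with compact support in the open unit cube. -/
structure IsTestFunction (φ : (ι → ℝ) → ℝ) : Prop where
  contDiff : ContDiff ℝ (⊤ : ℕ∞) φ
  hasCompactSupport : HasCompactSupport φ
  tsupport_subset : tsupport φ ⊆ openCube ι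

theorem IsTestFunction.partialDeriv {φ : (ι → ℝ) → ℝ} (h : IsTestFunction φ) (a : ι) :
    IsTestFunction (partialDeriv a φ) where
  contDiff := (h.contDiff.fderiv_right (m := (⊤ : ℕ∞)) (by simp)).clm_apply contDiff_const
  hasCompactSupport := h.hasCompactSupport.fderiv_apply ℝ _
  tsupport_subset := (tsupport_fderiv_apply_subset ℝ _).trans h.tsupport_subset

theorem IsTestFunction.foldr {φ : (ι → ℝ) → ℝ} (h : IsTestFunction φ) (l : List ι) :
    IsTestFunction (l.foldr AnchoredANOVA.partialDeriv φ) := by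
  induction l with
  | nil => exact h
  | cons a l ih => exact ih.partialDeriv a

theorem IsTestFunction.exists_bound {ι : Type*} [Fintype ι] {φ : (ι → ℝ) → ℝ} (h : IsTestFunction φ) :
    ∃ C, ∀ x, ‖φ x‖ ≤ C :=
  h.hasCompactSupport.exists_bound_of_continuous h.contDiff.continuous

theorem IsTestFunction.eq_zero {ι : Type*} [Fintype ι] {φ : (ι → ℝ) → ℝ} (h : IsTestFunction φ)
    {x : ι → ℝ} (i : ι) (hx : x i ∉ Set.Ioo (0 : ℝ) 1) : φ x = 0 :=
  image_eq_zero_of_notMem_tsupport fun hmem => hx (h.tsupport_subset hmem i trivial)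

theorem IsTestFunction.hasDerivAt_update {φ : (ι → ℝ) → ℝ} (h : IsTestFunction φ) (z : ι → ℝ)
    (a : ι) (r : ℝ) : HasDerivAt (fun r => φ (Function.update z a r))
      (AnchoredANOVA.partialDeriv a φ (Function.update z a r)) r :=
  ((h.contDiff.differentiable (by simp)).differentiableAt.hasFDerivAt.comp_hasDerivAt r
    (_root_.hasDerivAt_update z a r))

/-- Resampling one coordinate independently does not change the law of a uniform point; this
isolates the coordinate in which to integrate by parts. -/
theorem integral_cubeMeasure_eq_update (a : ι) {K : (ι → ℝ) → ℝ}
    (hK : Integrable K (cubeMeasure ι)) :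
    ∫ x, K x ∂cubeMeasure ι =
      ∫ x, (∫ r in Set.Icc (0 : ℝ) 1, K (Function.update x a r)) ∂cubeMeasure ι := by
  have hmp : MeasurePreserving (fun z : (ι → ℝ) × ℝ => Function.update z.1 a z.2)
      ((cubeMeasure ι).prod (volume.restrict (Set.Icc 0 1))) (cubeMeasure ι) := by
    have hm : Measurable fun z : (ι → ℝ) × ℝ => Function.update z.1 a z.2 := by
      refine measurable_pi_lambda _ fun i => ?_
      by_cases hi : i = a
      · subst hi; simpa using measurable_snd
      · simpa [hi, Function.comp_def] using (measurable_pi_apply i).comp measurable_fst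
    refine ⟨hm, ?_⟩
    have h1 := (measurePreserving_piecewise ({a}ᶜ : Finset ι)).map_eq
    have h2 : MeasurePreserving (Prod.map id (Function.eval a))
        ((cubeMeasure ι).prod (cubeMeasure ι))
        ((cubeMeasure ι).prod (volume.restrict (Set.Icc (0 : ℝ) 1))) := by
      refine (MeasurePreserving.id _).prod ?_
      rw [cubeMeasure_eq_pi]
      exact measurePreserving_eval _ a
    rw [← h2.map_eq, Measure.map_map hm h2.measurable]
    refine Eq.trans ?_ h1
    congr 1
    ext z i
    by_cases hi : i = a
    · subst hi; simp
    · simp [hi]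
  rw [← hmp.map_eq] at hK
  conv_lhs => rw [← hmp.map_eq]
  rw [integral_map hmp.aemeasurable hK.1, integral_prod]
  exact hK.comp_measurable hmp.measurable

/-- `τ` is the endpoint at which integration by parts against the kernel `k` evaluates. -/
def IsKernelAt (k : ℝ → ℝ) (τ : ℝ) : Prop :=
  Measurable k ∧ (∀ x, ‖k x‖ ≤ 1) ∧ ∀ g g' : ℝ → ℝ, (∀ x, HasDerivAt g (g' x) x) → Continuous g' →
    (∀ x ∉ Set.Ioo (0 : ℝ) 1, g x = 0) → ∫ x in Set.Icc (0 : ℝ) 1, k x * g' x = -g τ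

theorem isKernelAt_one : IsKernelAt (fun _ => 1) 0 := by
  refine ⟨measurable_const, by simp, fun g g' hg hc h0 => ?_⟩
  simp only [one_mul]
  rw [integral_Icc_eq_integral_Ioc, ← intervalIntegral.integral_of_le zero_le_one,
    intervalIntegral.integral_eq_sub_of_hasDerivAt (fun x _ => hg x) (hc.intervalIntegrable _ _),
    h0 1 (by simp), zero_sub]

theorem isKernelAt_indicator {t : ℝ} (ht : t ∈ Set.Icc (0 : ℝ) 1) :
    IsKernelAt (fun x => (Set.Ico 0 x).indicator (fun _ => (1 : ℝ)) t) t := by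
  have hk : (fun x => (Set.Ico 0 x).indicator (fun _ => (1 : ℝ)) t) =
      (Set.Ioi t).indicator fun _ => 1 := by
    ext x
    simp [Set.indicator, ht.1]
  rw [hk]
  refine ⟨measurable_const.indicator measurableSet_Ioi, fun x => ?_, fun g g' hg hc h0 => ?_⟩
  · exact (norm_indicator_le_norm_self _ _).trans (by simp)
  · have h1 : ∀ x, (Set.Ioi t).indicator (fun _ => (1 : ℝ)) x * g' x =
        (Set.Ioi t).indicator g' x := fun x => by
      by_cases hx : x ∈ Set.Ioi t <;> simp [hx]
    simp only [h1]
    have h2 : Set.Icc (0 : ℝ) 1 ∩ Set.Ioi t = Set.Ioc t 1 := by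
      ext x
      simp only [Set.mem_inter_iff, Set.mem_Icc, Set.mem_Ioi, Set.mem_Ioc]
      exact ⟨fun h => ⟨h.2, h.1.2⟩, fun h => ⟨⟨ht.1.trans h.1.le, h.2⟩, h.1⟩⟩
    rw [setIntegral_indicator measurableSet_Ioi, h2, ← intervalIntegral.integral_of_le ht.2,
      intervalIntegral.integral_eq_sub_of_hasDerivAt (fun x _ => hg x) (hc.intervalIntegrable _ _),
      h0 1 (by simp), zero_sub]

theorem norm_prod_le_one {ι : Type*} {s : Finset ι} {c : ι → ℝ} (h : ∀ i ∈ s, ‖c i‖ ≤ 1) :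
    ‖∏ i ∈ s, c i‖ ≤ 1 := by
  rw [norm_prod]
  exact Finset.prod_le_one (fun _ _ => norm_nonneg _) h

theorem measurable_piecewise_right {ι : Type*} [DecidableEq ι] (v : Finset ι) (t : ι → ℝ) :
    Measurable fun x : ι → ℝ => v.piecewise t x := by
  refine measurable_pi_lambda _ fun i => ?_
  by_cases hi : i ∈ v
  · simp [hi]
  · simpa [hi] using measurable_pi_apply i

/-- Each partial derivative is integrated by parts in its own coordinate: it consumes the kernel
there, freezes the coordinate at `τ`, and contributes a sign. -/
theorem integral_prod_mul_foldr_partialDeriv {k : ι → ℝ → ℝ} {τ : ι → ℝ}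
    (hk : ∀ j, IsKernelAt (k j) (τ j)) (l : List ι) (hl : l.Nodup) :
    ∀ ψ : (ι → ℝ) → ℝ, IsTestFunction ψ →
      ∫ x, (∏ j, k j (x j)) * l.foldr partialDeriv ψ x ∂cubeMeasure ι =
        (-1) ^ l.length *
          ∫ x, (∏ j ∈ l.toFinsetᶜ, k j (x j)) * ψ (l.toFinset.piecewise τ x) ∂cubeMeasure ι := by
  induction l using List.reverseRecOn with
  | nil =>
    intro ψ _
    have h : ∀ x : ι → ℝ, ([] : List ι).toFinset.piecewise τ x = x := fun x => by
      ext i; exact Finset.piecewise_eq_of_notMem _ _ _ (by simp)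
    simp only [h]
    simp
  | append_singleton l a ih =>
    -- The last entry of the list acts first on `ψ`, so the induction hypothesis is applied to
    -- `partialDeriv a ψ`, leaving one derivative to remove.
    intro ψ hψ
    have hal : a ∉ l := fun h => by
      rw [List.nodup_append] at hl
      exact hl.2.2 a h a (by simp) rfl
    have hal' : a ∈ l.toFinsetᶜ := by simpa using hal
    rw [List.foldr_append, List.foldr_cons, List.foldr_nil,
      ih (List.nodup_append.1 hl).1 _ (hψ.partialDeriv a), List.length_append, List.length_singleton,
      pow_succ, mul_assoc]
    congr 1
    have hi : Integrable (fun x => (∏ j ∈ l.toFinsetᶜ, k j (x j)) *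
        partialDeriv a ψ (l.toFinset.piecewise τ x)) (cubeMeasure ι) := by
      obtain ⟨C, hC⟩ := (hψ.partialDeriv a).exists_bound
      refine Integrable.of_bound (C := C) ?_ (Filter.Eventually.of_forall fun x => ?_)
      · refine (Measurable.mul (Finset.measurable_prod _ fun j _ =>
          (hk j).1.comp (measurable_pi_apply j)) ?_).aestronglyMeasurable
        exact (hψ.partialDeriv a).contDiff.continuous.measurable.comp
          (measurable_piecewise_right _ _)
      · rw [norm_mul]
        calc _ ≤ 1 * C := mul_le_mul (norm_prod_le_one fun j _ => (hk j).2.1 _) (hC _)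
              (norm_nonneg _) zero_le_one
          _ = C := one_mul C
    rw [integral_cubeMeasure_eq_update a hi, neg_one_mul, ← integral_neg]
    congr 1
    funext x
    have hset : (l ++ [a]).toFinset = insert a l.toFinset := by ext; simp
    have hset' : ((l ++ [a]).toFinset)ᶜ = l.toFinsetᶜ.erase a := by ext; simp
    have hpw : ∀ r, l.toFinset.piecewise τ (Function.update x a r) =
        Function.update (l.toFinset.piecewise τ x) a r := fun r => by
      ext i
      by_cases hia : i = a
      · subst hia; simp [hal]
      · by_cases hil : i ∈ l <;> simp [hia, hil]
    have hpw' : (l ++ [a]).toFinset.piecewise τ x =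
        Function.update (l.toFinset.piecewise τ x) a (τ a) := by
      ext i
      by_cases hia : i = a
      · subst hia; simp
      · by_cases hil : i ∈ l <;> simp [hia, hil]
    have hprod : ∀ r, ∏ j ∈ l.toFinsetᶜ, k j (Function.update x a r j) =
        (∏ j ∈ l.toFinsetᶜ.erase a, k j (x j)) * k a r := fun r => by
      rw [← Finset.prod_erase_mul _ _ hal']
      congr 1
      · exact Finset.prod_congr rfl fun j hj => by
          rw [Function.update_of_ne (Finset.ne_of_mem_erase hj)]
      · simp
    simp only [hpw, hprod, hpw', hset', mul_assoc]
    rw [integral_const_mul, (hk a).2.2 (fun r => ψ (Function.update (l.toFinset.piecewise τ x) a r))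
      _ (hψ.hasDerivAt_update _ a), mul_neg]
    · exact (hψ.partialDeriv a).contDiff.continuous.comp
        (continuous_const.update a continuous_id)
    · intro r hr
      exact hψ.eq_zero a (by simpa using hr)

end TestFunction

theorem integral_comp_of_measurePreserving {X Y : Type*} [MeasurableSpace X] [MeasurableSpace Y]
    {μ : Measure X} {ν : Measure Y} {f : X → Y} (hf : MeasurePreserving f μ ν) {g : Y → ℝ}
    (hg : AEStronglyMeasurable g ν) : ∫ x, g (f x) ∂μ = ∫ y, g y ∂ν := by
  rw [← hf.map_eq] at hg ⊢
  exact (integral_map hf.aemeasurable hg).symm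

/-- The kernel `1_{[0,x)}(t)`. -/
noncomputable def indKernel (x t : ℝ) : ℝ := (Set.Ico (0 : ℝ) x).indicator (fun _ => (1 : ℝ)) t

theorem measurable_indKernel : Measurable fun z : ℝ × ℝ => indKernel z.1 z.2 := by
  have : (fun z : ℝ × ℝ => indKernel z.1 z.2) =
      ({z : ℝ × ℝ | 0 ≤ z.2 ∧ z.2 < z.1} : Set (ℝ × ℝ)).indicator fun _ => 1 := by
    ext z
    simp [indKernel, Set.indicator]
  rw [this]
  exact measurable_const.indicator ((measurableSet_le measurable_const measurable_snd).inter
    (measurableSet_lt measurable_snd measurable_fst))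

theorem indKernel_nonneg (x t : ℝ) : 0 ≤ indKernel x t :=
  Set.indicator_nonneg (fun _ _ => zero_le_one) _

theorem indKernel_le_one (x t : ℝ) : indKernel x t ≤ 1 :=
  Set.indicator_le_self' (fun _ _ => zero_le_one) _

theorem norm_indKernel_le (x t : ℝ) : ‖indKernel x t‖ ≤ 1 := by
  rw [Real.norm_of_nonneg (indKernel_nonneg x t)]
  exact indKernel_le_one x t

theorem norm_indKernel_sub_le (x : ℝ) {t : ℝ} (ht : t ∈ Set.Icc (0 : ℝ) 1) :
    ‖indKernel x t - (1 - t)‖ ≤ 1 := by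
  have := indKernel_nonneg x t
  have := indKernel_le_one x t
  rw [Real.norm_eq_abs, abs_le]
  constructor <;> linarith [ht.1, ht.2]

/-! ### Anchored terms and their candidate derivatives -/

section Terms

variable {ι : Type*} [Fintype ι] [DecidableEq ι]

theorem measurable_prod_indKernel {ι : Type*} (s : Finset ι) :
    Measurable fun z : (ι → ℝ) × (ι → ℝ) => ∏ j ∈ s, indKernel (z.1 j) (z.2 j) :=
  Finset.measurable_prod _ fun j _ => by
    have h : Measurable fun z : (ι → ℝ) × (ι → ℝ) => (z.1 j, z.2 j) := by fun_prop
    exact measurable_indKernel.comp h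

/-- The mixed derivative in the coordinates `v` of
`x ↦ ∫ H(t) ∏_{j ∈ w} 1_{[0,x_j)}(t_j) dt`, where `v ⊆ w`. -/
noncomputable def mixedAnchored (H : (ι → ℝ) → ℝ) (w v : Finset ι) (x : ι → ℝ) : ℝ :=
  ∫ t, H (v.piecewise x t) * ∏ j ∈ w \ v, indKernel (x j) (t j) ∂cubeMeasure ι

theorem integrable_mixedAnchored_integrand {H : (ι → ℝ) → ℝ} (hH : Integrable H (cubeMeasure ι))
    (w v : Finset ι) :
    Integrable (fun z : (ι → ℝ) × (ι → ℝ) =>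
      H (v.piecewise z.1 z.2) * ∏ j ∈ w \ v, indKernel (z.1 j) (z.2 j))
      ((cubeMeasure ι).prod (cubeMeasure ι)) :=
  ((measurePreserving_piecewise v).integrable_comp_of_integrable hH).mul_bdd
    (measurable_prod_indKernel _).aestronglyMeasurable
    (Filter.Eventually.of_forall fun _ => norm_prod_le_one fun _ _ => norm_indKernel_le _ _)

theorem integrable_mixedAnchored {H : (ι → ℝ) → ℝ} (hH : Integrable H (cubeMeasure ι))
    (w v : Finset ι) : Integrable (mixedAnchored H w v) (cubeMeasure ι) :=
  (integrable_mixedAnchored_integrand hH w v).integral_prod_left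

/-- Jensen removes the integral over `t`, the kernels are at most one, and `v.piecewise x t` is
again uniform on the cube. -/
theorem eLpNorm_mixedAnchored_le {p : ℝ≥0∞} (hp : 1 ≤ p) {H : (ι → ℝ) → ℝ}
    (hH : MemLp H p (cubeMeasure ι)) (w v : Finset ι) :
    eLpNorm (mixedAnchored H w v) p (cubeMeasure ι) ≤ eLpNorm H p (cubeMeasure ι) := by
  refine (eLpNorm_integral_le hp
    (integrable_mixedAnchored_integrand (hH.integrable hp) w v).1).trans ?_
  rw [← eLpNorm_comp_measurePreserving hH.1 (measurePreserving_piecewise v)]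
  refine eLpNorm_mono fun z => ?_
  rw [norm_mul]
  exact mul_le_of_le_one_right (norm_nonneg _)
    (norm_prod_le_one fun _ _ => norm_indKernel_le _ _)

theorem mixedAnchored_empty (H : (ι → ℝ) → ℝ) (w : Finset ι) (x : ι → ℝ) :
    mixedAnchored H w ∅ x = ∫ t, H t * ∏ j ∈ w, indKernel (x j) (t j) ∂cubeMeasure ι := by
  simp [mixedAnchored, Finset.piecewise_empty]

theorem integral_prod_indKernel_mul_foldr {t : ι → ℝ} (ht : t ∈ cube ι) (w : Finset ι) {l : List ι}
    (hl : l.Nodup) {v : Finset ι} (hv : l.toFinset = v) {φ : (ι → ℝ) → ℝ} (hφ : IsTestFunction φ) :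
    ∫ x, (∏ j ∈ w, indKernel (x j) (t j)) * l.foldr partialDeriv φ x ∂cubeMeasure ι =
      if v ⊆ w then (-1) ^ l.length *
        ∫ x, (∏ j ∈ w \ v, indKernel (x j) (t j)) * φ (v.piecewise t x)
          ∂cubeMeasure ι
      else 0 := by
  subst hv
  -- Coordinates outside `w` carry the constant kernel 1, whose endpoint is 0, where test functions
  -- vanish.
  let k : ι → ℝ → ℝ := fun j x => if j ∈ w then indKernel x (t j) else 1
  have hk : ∀ j, IsKernelAt (k j) (w.piecewise t 0 j) := fun j => by
    by_cases hj : j ∈ w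
    · simpa [k, hj, indKernel] using isKernelAt_indicator (ht j trivial)
    · simpa [k, hj] using isKernelAt_one
  have h := integral_prod_mul_foldr_partialDeriv hk l hl φ hφ
  have hprod : ∀ (s : Finset ι) (x : ι → ℝ),
      ∏ j ∈ s, k j (x j) = ∏ j ∈ s ∩ w, indKernel (x j) (t j) := fun s x => by
    rw [← Finset.filter_mem_eq_inter, Finset.prod_filter]
  simp only [hprod, Finset.univ_inter] at h
  rw [h]
  split_ifs with hsub
  · congr 2
    funext x
    congr 2
    · ext j; simp [and_comm]
    · ext j
      by_cases hj : j ∈ l.toFinset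
      · simp only [Finset.piecewise_eq_of_mem _ _ _ hj, Finset.piecewise_eq_of_mem _ _ _ (hsub hj)]
      · simp only [Finset.piecewise_eq_of_notMem _ _ _ hj]
  -- A coordinate of `v` outside `w` is frozen at 0, on the boundary of the cube, so the test
  -- function is zero.
  · obtain ⟨a, ha, haw⟩ := Finset.not_subset.1 hsub
    have h0 : ∀ x, φ (l.toFinset.piecewise (w.piecewise t 0) x) = 0 := fun x =>
      hφ.eq_zero a (by simp [Finset.piecewise_eq_of_mem _ _ _ ha, haw])
    simp [h0]

/-- Swapping the `v`-coordinates of the two independent points `x` and `t` preserves the product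
measure and moves the substitution from `H` to `φ`. The inner integral is then in the form produced
by integration by parts. -/
theorem integral_mixedAnchored_mul {H : (ι → ℝ) → ℝ} (hH : Integrable H (cubeMeasure ι))
    (w v : Finset ι) {φ : (ι → ℝ) → ℝ} (hφ : IsTestFunction φ) :
    ∫ x, mixedAnchored H w v x * φ x ∂cubeMeasure ι =
      ∫ t, H t * ∫ x, (∏ j ∈ w \ v, indKernel (x j) (t j)) * φ (v.piecewise t x) ∂cubeMeasure ι
        ∂cubeMeasure ι := by
  obtain ⟨C, hC⟩ := hφ.exists_bound
  have hcont := hφ.contDiff.continuous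
  let Ψ : (ι → ℝ) × (ι → ℝ) → ℝ := fun z =>
    H z.1 * ((∏ j ∈ w \ v, indKernel (z.2 j) (z.1 j)) * φ (v.piecewise z.1 z.2))
  have hΨ : Integrable Ψ ((cubeMeasure ι).prod (cubeMeasure ι)) := by
    refine (hH.comp_fst _).mul_bdd (c := C) ?_ (Filter.Eventually.of_forall fun z => ?_)
    · exact (((measurable_prod_indKernel _).comp measurable_swap).mul (hcont.measurable.comp
        (measurePreserving_piecewise v).measurable)).aestronglyMeasurable
    · rw [norm_mul]
      calc _ ≤ 1 * C := mul_le_mul (norm_prod_le_one fun j _ => norm_indKernel_le _ _) (hC _)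
            (norm_nonneg _) zero_le_one
        _ = C := one_mul C
  have hpull : ∀ x t : ι → ℝ, H (v.piecewise x t) * (∏ j ∈ w \ v, indKernel (x j) (t j)) * φ x =
      Ψ (v.piecewise x t, v.piecewise t x) := fun x t => by
    have h1 : v.piecewise (v.piecewise x t) (v.piecewise t x) = x := by
      ext j; by_cases hj : j ∈ v <;> simp [hj]
    have h2 : ∏ j ∈ w \ v, indKernel (v.piecewise t x j) (v.piecewise x t j) =
        ∏ j ∈ w \ v, indKernel (x j) (t j) :=
      Finset.prod_congr rfl fun j hj => by
        have hj := (Finset.mem_sdiff.1 hj).2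
        simp [hj]
    simp only [Ψ, h1, h2, mul_assoc]
  have hmp := measurePreserving_exchange (ι := ι) v
  calc ∫ x, mixedAnchored H w v x * φ x ∂cubeMeasure ι
      = ∫ x, ∫ t, Ψ (v.piecewise x t, v.piecewise t x) ∂cubeMeasure ι ∂cubeMeasure ι := by
        simp only [← hpull, mixedAnchored, integral_mul_const]
    _ = ∫ z, Ψ (v.piecewise z.1 z.2, v.piecewise z.2 z.1)
          ∂(cubeMeasure ι).prod (cubeMeasure ι) :=
        (integral_prod _ (hmp.integrable_comp_of_integrable hΨ)).symm
    _ = ∫ z, Ψ z ∂(cubeMeasure ι).prod (cubeMeasure ι) :=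
        integral_comp_of_measurePreserving hmp hΨ.1
    _ = _ := by
        rw [integral_prod _ hΨ]
        simp only [Ψ, integral_const_mul]

end Terms

/-! ### Weak derivatives of anchored terms -/

section WeakDerivative

variable {ι : Type*} [Fintype ι] [LinearOrder ι]

/-- After Fubini, integration by parts is done for fixed `t`, where only kernels and test functions
are differentiated; `H` needs no regularity beyond integrability. -/
theorem isMixedDeriv_mixedAnchored {H : (ι → ℝ) → ℝ} (hH : Integrable H (cubeMeasure ι))
    (w v : Finset ι) :
    IsMixedDeriv v (mixedAnchored H w ∅) (if v ⊆ w then mixedAnchored H w v else 0) where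
  integrable_fun := integrable_mixedAnchored hH w ∅
  integrable_deriv := by
    split_ifs
    · exact integrable_mixedAnchored hH w v
    · exact integrable_zero _ _ _
  integral_eq := fun φ h1 h2 h3 => by
    have hφ : IsTestFunction φ := ⟨h1, h2, h3⟩
    have hD : IsTestFunction (mixedPartial v φ) := hφ.foldr _
    rw [integral_mixedAnchored_mul hH w ∅ hD]
    have hpt : ∀ᵐ t ∂cubeMeasure ι,
        H t * ∫ x, (∏ j ∈ w \ ∅, indKernel (x j) (t j)) *
          mixedPartial v φ (Finset.piecewise ∅ t x) ∂cubeMeasure ι =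
        if v ⊆ w then (-1) ^ v.card * (H t *
          ∫ x, (∏ j ∈ w \ v, indKernel (x j) (t j)) * φ (v.piecewise t x) ∂cubeMeasure ι)
        else 0 := by
      filter_upwards [ae_mem_cube] with t ht
      have := integral_prod_indKernel_mul_foldr ht w (v.sort_nodup (· ≤ ·))
        (v.sort_toFinset (· ≤ ·)) hφ
      simp only [Finset.length_sort] at this
      simp only [Finset.sdiff_empty, Finset.piecewise_empty, mixedPartial]
      rw [this]
      split_ifs <;> ring
    rw [integral_congr_ae hpt]
    split_ifs with hvw
    · rw [integral_const_mul, integral_mixedAnchored_mul hH w v hφ]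
    · simp

theorem IsMixedDeriv.sum {κ : Type*} {v : Finset ι} {S : Finset κ} {g G : κ → (ι → ℝ) → ℝ}
    (h : ∀ i ∈ S, IsMixedDeriv v (g i) (G i)) :
    IsMixedDeriv v (fun x => ∑ i ∈ S, g i x) (fun x => ∑ i ∈ S, G i x) where
  integrable_fun := integrable_finsetSum _ fun i hi => (h i hi).integrable_fun
  integrable_deriv := integrable_finsetSum _ fun i hi => (h i hi).integrable_deriv
  integral_eq := fun φ h1 h2 h3 => by
    have hφ : IsTestFunction φ := ⟨h1, h2, h3⟩
    have hD : IsTestFunction (mixedPartial v φ) := hφ.foldr _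
    have hint : ∀ {f ψ : (ι → ℝ) → ℝ}, Integrable f (cubeMeasure ι) → IsTestFunction ψ →
        Integrable (fun x => f x * ψ x) (cubeMeasure ι) := fun hf hψ => by
      obtain ⟨C, hC⟩ := hψ.exists_bound
      exact hf.mul_bdd hψ.contDiff.continuous.aestronglyMeasurable
        (Filter.Eventually.of_forall hC)
    simp only [Finset.sum_mul]
    rw [integral_finsetSum _ fun i hi => hint (h i hi).integrable_fun hD,
      integral_finsetSum _ fun i hi => hint (h i hi).integrable_deriv hφ, Finset.mul_sum]
    exact Finset.sum_congr rfl fun i hi => (h i hi).integral_eq φ h1 h2 h3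

end WeakDerivative

/-- Integrals over a smaller cube as integrals over a larger cube. -/
theorem integral_mul_prod_eq_embedding {α ι : Type*} [Fintype α] [Fintype ι] (e : α ↪ ι)
    {h : (α → ℝ) → ℝ} (hh : AEStronglyMeasurable h (cubeMeasure α)) {k : ι → ℝ → ℝ}
    (hk : ∀ j, Measurable (k j)) :
    ∫ t, h t * ∏ a, k (e a) (t a) ∂cubeMeasure α =
      ∫ t, h (t ∘ e) * ∏ j ∈ Finset.univ.map e, k j (t j) ∂cubeMeasure ι := by
  have hm : Measurable fun t : α → ℝ => ∏ a, k (e a) (t a) :=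
    Finset.measurable_prod _ fun a _ => (hk (e a)).comp (measurable_pi_apply a)
  have h := integral_comp_of_measurePreserving (measurePreserving_comp_injective e.injective)
    (hh.mul hm.aestronglyMeasurable)
  simp only [Finset.prod_map]
  exact h.symm

/-! ### Anchored parts, ANOVA parts and membership in the ANOVA space -/

section Spaces

variable {s : ℕ}

instance sFinite_cubeMeasure {ι : Type*} [Fintype ι] : SFinite (cubeMeasure ι) := inferInstance

/-- A function of the coordinates in `u` as a function of all coordinates. -/
def extend (u : Finset (Fin s)) (h : (↥u → ℝ) → ℝ) (t : Fin s → ℝ) : ℝ := h (t ∘ (↑))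

theorem measurePreserving_restrict (u : Finset (Fin s)) :
    MeasurePreserving (fun t : Fin s → ℝ => t ∘ ((↑) : ↥u → Fin s)) (cubeMeasure (Fin s))
      (cubeMeasure ↥u) :=
  measurePreserving_comp_injective Subtype.val_injective

theorem memLp_extend {p : ℝ≥0∞} {u : Finset (Fin s)} {h : (↥u → ℝ) → ℝ}
    (hh : MemLp h p (cubeMeasure ↥u)) : MemLp (extend u h) p (cubeMeasure (Fin s)) :=
  hh.comp_measurePreserving (measurePreserving_restrict u)

theorem eLpNorm_extend {p : ℝ≥0∞} {u : Finset (Fin s)} {h : (↥u → ℝ) → ℝ}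
    (hh : AEStronglyMeasurable h (cubeMeasure ↥u)) :
    eLpNorm (extend u h) p (cubeMeasure (Fin s)) = eLpNorm h p (cubeMeasure ↥u) :=
  eLpNorm_comp_measurePreserving hh (measurePreserving_restrict u)

theorem mixedAnchored_univ {ι : Type*} [Fintype ι] [DecidableEq ι] (H : (ι → ℝ) → ℝ)
    (w : Finset ι) : mixedAnchored H w Finset.univ = H := by
  funext x
  simp [mixedAnchored, Finset.sdiff_eq_empty_iff_subset.2 (Finset.subset_univ w)]

theorem univ_map_subtype (u : Finset (Fin s)) :
    (Finset.univ : Finset ↥u).map (Function.Embedding.subtype _) = u := by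
  ext j; simp

theorem measurable_indKernel_right (x : ℝ) : Measurable (indKernel x) :=
  measurable_const.indicator measurableSet_Ico

theorem anchoredTerm_eq_mixedAnchored {u : Finset (Fin s)} {h : (↥u → ℝ) → ℝ}
    (hh : AEStronglyMeasurable h (cubeMeasure ↥u)) (x : Fin s → ℝ) :
    anchoredTerm u h x = mixedAnchored (extend u h) u ∅ x := by
  rw [mixedAnchored_empty]
  have := integral_mul_prod_eq_embedding (Function.Embedding.subtype (· ∈ u)) hh
    (fun j => measurable_indKernel_right (x j))
  erw [univ_map_subtype] at this
  exact this

theorem isMixedDeriv_zero {ι : Type*} [Fintype ι] [LinearOrder ι] (v : Finset ι) :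
    IsMixedDeriv v (fun _ => 0) (0 : (ι → ℝ) → ℝ) := by
  constructor <;> simp

theorem anchoredTerm_glue_eq_zero {w u : Finset (Fin s)} (hwu : ¬ w ⊆ u) (h : (↥w → ℝ) → ℝ)
    (y : ↥u → ℝ) : anchoredTerm w h (glue u y fun _ => 0) = 0 := by
  obtain ⟨j, hjw, hju⟩ := Finset.not_subset.1 hwu
  have h0 : ∀ t : ↥w → ℝ, ∏ i : ↥w, (Set.Ico (0 : ℝ) (glue u y (fun _ => 0) i)).indicator
      (fun _ => (1 : ℝ)) (t i) = 0 := fun t =>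
    Finset.prod_eq_zero (Finset.mem_univ ⟨j, hjw⟩) (by simp [glue, hju])
  simp only [anchoredTerm, h0, mul_zero, integral_zero]

theorem isMixedDeriv_anchoredTerm_glue {w u : Finset (Fin s)} (hwu : w ⊆ u) {h : (↥w → ℝ) → ℝ}
    (hh : Integrable h (cubeMeasure ↥w)) :
    IsMixedDeriv Finset.univ (fun y => anchoredTerm w h (glue u y fun _ => 0))
      (if w = u then fun y => h fun a => y ⟨a, hwu a.2⟩ else 0) := by
  let e : ↥w ↪ ↥u := ⟨fun a => ⟨a, hwu a.2⟩, fun a b hab =>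
    Subtype.ext (congrArg (fun c : ↥u => (c : Fin s)) hab)⟩
  have hH : Integrable (fun t : ↥u → ℝ => h (t ∘ e)) (cubeMeasure ↥u) :=
    (measurePreserving_comp_injective e.injective).integrable_comp_of_integrable hh
  have hterm : (fun y => anchoredTerm w h (glue u y fun _ => 0)) =
      mixedAnchored (fun t : ↥u → ℝ => h (t ∘ e)) (Finset.univ.map e) ∅ := by
    funext y
    rw [mixedAnchored_empty]
    rw [← integral_mul_prod_eq_embedding e hh.1 (fun j => measurable_indKernel_right (y j))]
    simp only [anchoredTerm]
    congr 1
    funext t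
    congr 1
    refine Finset.prod_congr rfl fun a _ => ?_
    have hg : glue u y (fun _ => 0) a = y (e a) := by simp only [glue, hwu a.2, dif_pos]; rfl
    rw [hg, indKernel]
  rw [hterm]
  -- The derivative in all coordinates of `u` survives only when every one of them occurs in `w`.
  have hiff : (Finset.univ : Finset ↥u) ⊆ Finset.univ.map e ↔ w = u := by
    constructor
    · intro hs
      refine hwu.antisymm fun j hj => ?_
      obtain ⟨a, -, ha⟩ := Finset.mem_map.1 (hs (Finset.mem_univ ⟨j, hj⟩))
      have : (a : Fin s) = j := congrArg Subtype.val ha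
      exact this ▸ a.2
    · rintro rfl a _
      exact Finset.mem_map.2 ⟨a, Finset.mem_univ _, rfl⟩
  convert isMixedDeriv_mixedAnchored hH (Finset.univ.map e) Finset.univ using 1
  · congr!
  by_cases hw : w = u
  · rw [if_pos hw, if_pos (hiff.2 hw)]
    rw [mixedAnchored_univ]
    rfl
  · rw [if_neg hw, if_neg (hiff.not.2 hw)]

/-- The data of a function in the anchored space. -/
structure IsAnchoredRep (p : ℝ≥0∞) (S : Finset (Finset (Fin s))) (f : (Fin s → ℝ) → ℝ)
    (h : ∀ u : Finset (Fin s), (↥u → ℝ) → ℝ) : Prop where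
  memLp : ∀ u ∈ S, MemLp (h u) p (cubeMeasure ↥u)
  eq_sum : ∀ x ∈ cube (Fin s), f x = ∑ u ∈ S, anchoredTerm u (h u) x

variable {p : ℝ≥0∞} {S : Finset (Finset (Fin s))} {f : (Fin s → ℝ) → ℝ}
  {h : ∀ u : Finset (Fin s), (↥u → ℝ) → ℝ}

theorem glue_mem_cube {u : Finset (Fin s)} {y : ↥u → ℝ} (hy : y ∈ cube ↥u) :
    (glue u y fun _ => 0) ∈ cube (Fin s) := by
  intro j _
  by_cases hj : j ∈ u
  · simpa [glue, hj] using hy ⟨j, hj⟩ trivial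
  · simp [glue, hj]

theorem IsAnchoredRep.isMixedDeriv_glue (hf : IsAnchoredRep p S f h) (hp : 1 ≤ p)
    {u : Finset (Fin s)} (hu : u ∈ S) :
    IsMixedDeriv (Finset.univ : Finset ↥u) (fun y => f (glue u y fun _ => 0)) (h u) := by
  have key : ∀ w ∈ S, IsMixedDeriv (Finset.univ : Finset ↥u)
      (fun y => anchoredTerm w (h w) (glue u y fun _ => 0)) (if w = u then h u else 0) := by
    intro w hw
    by_cases hwu : w ⊆ u
    · convert isMixedDeriv_anchoredTerm_glue hwu ((hf.memLp w hw).integrable hp) using 1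
      split_ifs with heq
      · subst heq; rfl
      · rfl
    · have hne : w ≠ u := fun heq => hwu heq.subset
      simp only [anchoredTerm_glue_eq_zero hwu, if_neg hne]
      exact isMixedDeriv_zero _
  have hsum := (IsMixedDeriv.sum key).congr fun y hy => hf.eq_sum _ (glue_mem_cube hy)
  convert hsum using 1
  funext y
  rw [Finset.sum_eq_single_of_mem u hu fun w _ hw => by simp [hw]]
  simp

theorem IsAnchoredRep.anchoredPart_eq (hf : IsAnchoredRep p S f h) (hp : 1 ≤ p)
    {u : Finset (Fin s)} (hu : u ∈ S) :
    anchoredPart p u f = eLpNorm (h u) p (cubeMeasure ↥u) := by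
  have hd := hf.isMixedDeriv_glue hp hu
  exact le_antisymm (iInf₂_le _ hd)
    (le_iInf₂ fun G hG => (eLpNorm_congr_ae (hd.ae_eq hG)).le)

/-- The average over the coordinates outside `v` is a contraction, and gluing preserves the measure.
The triangle inequality then leaves the norms of the derivatives of the single terms, which vanish
unless `v ⊆ w`. -/
theorem IsAnchoredRep.anovaPart_le (hf : IsAnchoredRep p S f h) (hp : 1 ≤ p)
    (v : Finset (Fin s)) :
    anovaPart p v f ≤ ∑ w ∈ S with v ⊆ w, eLpNorm (h w) p (cubeMeasure ↥w) := by
  have key : ∀ w ∈ S, IsMixedDeriv v (anchoredTerm w (h w))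
      (if v ⊆ w then mixedAnchored (extend w (h w)) w v else 0) := fun w hw => by
    rw [funext (anchoredTerm_eq_mixedAnchored (hf.memLp w hw).1)]
    exact isMixedDeriv_mixedAnchored ((memLp_extend (hf.memLp w hw)).integrable hp) w v
  have hd := (IsMixedDeriv.sum key).congr hf.eq_sum
  refine (iInf₂_le _ hd).trans ?_
  have hmp := measurePreserving_glue v
  refine (eLpNorm_integral_le hp (hd.integrable_deriv.1.comp_measurePreserving hmp)).trans ?_
  refine (eLpNorm_comp_measurePreserving hd.integrable_deriv.1 hmp).trans_le ?_
  rw [← Finset.sum_fn, Finset.sum_filter]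
  refine (eLpNorm_sum_le (fun w hw => (key w hw).integrable_deriv.1) hp).trans ?_
  refine Finset.sum_le_sum fun w hw => ?_
  split_ifs
  · exact (eLpNorm_mixedAnchored_le hp (memLp_extend (hf.memLp w hw)) w v).trans_eq
      (eLpNorm_extend (hf.memLp w hw).1)
  · simp

/-- Averaging over the coordinates outside `v`. -/
noncomputable def average (v : Finset (Fin s)) (Φ : (Fin s → ℝ) → ℝ) (y : ↥v → ℝ) : ℝ :=
  ∫ t, Φ (glue v y t) ∂cubeMeasure {j : Fin s // j ∉ v}

theorem memLp_average (hp : 1 ≤ p) (v : Finset (Fin s)) {Φ : (Fin s → ℝ) → ℝ}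
    (hΦ : MemLp Φ p (cubeMeasure (Fin s))) : MemLp (average v Φ) p (cubeMeasure ↥v) := by
  have hmp := measurePreserving_glue v
  have h := hΦ.comp_measurePreserving hmp
  exact ⟨h.1.integral_prod_right', (eLpNorm_integral_le hp h.1).trans_lt h.2⟩

/-- The product involves only coordinates in `v`, so it passes through the average, and Fubini
applies; the bound on the kernels gives integrability. -/
theorem integral_average_mul (v : Finset (Fin s)) {Φ : (Fin s → ℝ) → ℝ}
    (hΦ : Integrable Φ (cubeMeasure (Fin s))) {k : Fin s → ℝ → ℝ} (hk : ∀ j, Measurable (k j))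
    (hk1 : ∀ j, ∀ t ∈ Set.Icc (0 : ℝ) 1, ‖k j t‖ ≤ 1) :
    ∫ y, average v Φ y * ∏ a : ↥v, k a (y a) ∂cubeMeasure ↥v =
      ∫ z, Φ z * ∏ j ∈ v, k j (z j) ∂cubeMeasure (Fin s) := by
  have hmp := measurePreserving_glue v
  have hint : Integrable (fun z => Φ z * ∏ j ∈ v, k j (z j)) (cubeMeasure (Fin s)) := by
    refine hΦ.mul_bdd (c := 1) (Finset.measurable_prod _ fun j _ =>
      (hk j).comp (measurable_pi_apply j)).aestronglyMeasurable ?_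
    filter_upwards [ae_mem_cube] with z hz
    exact norm_prod_le_one fun j _ => hk1 j _ (hz j trivial)
  rw [← integral_comp_of_measurePreserving hmp hint.1]
  refine Eq.trans ?_ (integral_prod _ (hmp.integrable_comp_of_integrable hint)).symm
  congr 1
  funext y
  rw [average, ← integral_mul_const]
  congr 1
  funext t
  congr 1
  refine Eq.trans (Finset.prod_congr rfl fun a _ => ?_)
    (Finset.prod_coe_sort v fun j => k j (glue v y t j))
  simp only [glue, a.2, dif_pos]

/-- Expanding the product of `1_{[0,x_j)} = K_j + (1 - t_j)` over `w` yields one ANOVA term for each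
`v ⊆ w`. Its coefficient is `h_w ∏_{j ∈ w \ v} (1 - t_j)` averaged over the coordinates outside `v`.
-/
theorem IsAnchoredRep.mem_anova (hf : IsAnchoredRep p S f h) (hp : 1 ≤ p)
    (hS : ∀ u ∈ S, ∀ v ⊆ u, v ∈ S) :
    ∃ g : ∀ u : Finset (Fin s), (↥u → ℝ) → ℝ,
      (∀ u ∈ S, MemLp (g u) p (cubeMeasure ↥u)) ∧
      ∀ x ∈ cube (Fin s), f x = ∑ u ∈ S, anovaTerm u (g u) x := by
  let Φ : Finset (Fin s) → Finset (Fin s) → (Fin s → ℝ) → ℝ := fun v w z =>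
    extend w (h w) z * ∏ j ∈ w \ v, (1 - z j)
  have hΦ : ∀ v, ∀ w ∈ S, MemLp (Φ v w) p (cubeMeasure (Fin s)) := by
    intro v w hw
    have hH := memLp_extend (hf.memLp w hw)
    refine hH.mono (hH.1.mul (Finset.measurable_prod _ fun j _ =>
      measurable_const.sub (measurable_pi_apply j)).aestronglyMeasurable) ?_
    filter_upwards [ae_mem_cube] with z hz
    rw [norm_mul]
    refine mul_le_of_le_one_right (norm_nonneg _) (norm_prod_le_one fun j _ => ?_)
    have := hz j trivial
    rw [Real.norm_eq_abs, abs_le]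
    constructor <;> linarith [this.1, this.2]
  let K : (Fin s → ℝ) → Fin s → ℝ → ℝ := fun x j t => indKernel (x j) t - (1 - t)
  have hK : ∀ x j, Measurable (K x j) := fun x j =>
    (measurable_indKernel_right _).sub (measurable_const.sub measurable_id)
  have hK1 : ∀ x j, ∀ t ∈ Set.Icc (0 : ℝ) 1, ‖K x j t‖ ≤ 1 := fun x j t ht =>
    norm_indKernel_sub_le _ ht
  have hbdd : ∀ {ι : Type} [Fintype ι] (x : ι → ℝ) (v : Finset ι), ∀ᵐ z ∂cubeMeasure ι,
      ‖∏ j ∈ v, (indKernel (x j) (z j) - (1 - z j))‖ ≤ 1 := by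
    intro ι _ x v
    filter_upwards [ae_mem_cube] with z hz
    exact norm_prod_le_one fun j _ => norm_indKernel_sub_le _ (hz j trivial)
  have hmeas : ∀ {ι : Type} [Fintype ι] (x : ι → ℝ) (v : Finset ι),
      AEStronglyMeasurable (fun z : ι → ℝ => ∏ j ∈ v, (indKernel (x j) (z j) - (1 - z j)))
        (cubeMeasure ι) := by
    intro ι _ x v
    exact (Finset.measurable_prod _ fun j _ =>
      ((measurable_indKernel_right _).comp (measurable_pi_apply j)).sub
        (measurable_const.sub (measurable_pi_apply j))).aestronglyMeasurable
  refine ⟨fun v y => ∑ w ∈ S with v ⊆ w, average v (Φ v w) y, fun v _ => ?_, fun x hx => ?_⟩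
  · exact memLp_finsetSum _ fun w hw =>
      memLp_average hp v (hΦ v w (Finset.mem_filter.1 hw).1)
  · have hterm : ∀ w ∈ S, anchoredTerm w (h w) x =
        ∑ v ∈ w.powerset, ∫ z, Φ v w z * ∏ j ∈ v, K x j (z j) ∂cubeMeasure (Fin s) := by
      intro w hw
      rw [anchoredTerm_eq_mixedAnchored (hf.memLp w hw).1, mixedAnchored_empty,
        ← integral_finsetSum]
      · congr 1
        funext z
        have h1 : ∏ j ∈ w, indKernel (x j) (z j) = ∏ j ∈ w, (K x j (z j) + (1 - z j)) :=
          Finset.prod_congr rfl fun j _ => by simp [K]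
        rw [h1, Finset.prod_add, Finset.mul_sum]
        exact Finset.sum_congr rfl fun v _ => by simp only [Φ]; ring
      · intro v _
        exact ((hΦ v w hw).integrable hp).mul_bdd (hmeas x v) (hbdd x v)
    have hanova : ∀ v ∈ S, anovaTerm v (fun y => ∑ w ∈ S with v ⊆ w, average v (Φ v w) y) x =
        ∑ w ∈ S with v ⊆ w, ∫ z, Φ v w z * ∏ j ∈ v, K x j (z j) ∂cubeMeasure (Fin s) := by
      intro v _
      simp only [anovaTerm, Finset.sum_mul]
      rw [integral_finsetSum]
      · refine Finset.sum_congr rfl fun w hw => ?_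
        exact integral_average_mul v ((hΦ v w (Finset.mem_filter.1 hw).1).integrable hp) (hK x)
          (hK1 x)
      · intro w hw
        exact ((memLp_average hp v (hΦ v w (Finset.mem_filter.1 hw).1)).integrable hp).mul_bdd
          (hmeas (fun a : ↥v => x a) Finset.univ) (hbdd (fun a : ↥v => x a) Finset.univ)
    rw [hf.eq_sum x hx, Finset.sum_congr rfl hterm, Finset.sum_congr rfl hanova]
    -- Downward closure of `S` ensures that every subset `v` produced by the expansion is an
    -- admissible index.
    refine Finset.sum_comm' fun w v => ?_
    simp only [Finset.mem_powerset, Finset.mem_filter]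
    exact ⟨fun h => ⟨h, hS w h.1 v h.2⟩, fun h => h.1⟩

end Spaces

/-! ### Weighted ℓ_p sums and a Schur-type bound -/

section LpSum

variable {p pstar : ℝ≥0∞}

theorem one_le_of_holderConjugate (hp : ENNReal.HolderConjugate p pstar) : 1 ≤ p := by
  have h := hp.inv_add_inv_eq_inv
  rw [inv_one] at h
  exact ENNReal.inv_le_one.1 (h ▸ le_self_add)

theorem toReal_inv_add (hp : ENNReal.HolderConjugate p pstar) :
    p⁻¹.toReal + (1 / pstar).toReal = 1 := by
  have h := hp.inv_add_inv_eq_inv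
  rw [inv_one] at h
  have h1 : p⁻¹ ≠ ∞ := ne_top_of_le_ne_top ENNReal.one_ne_top (h ▸ le_self_add)
  have h2 : pstar⁻¹ ≠ ∞ := ne_top_of_le_ne_top ENNReal.one_ne_top (h ▸ le_add_self)
  rw [one_div, ← ENNReal.toReal_add h1 h2, h, ENNReal.toReal_one]

theorem le_lpSum {α : Type*} (hp : 1 ≤ p) {S : Finset α} (a : α → ℝ≥0∞) {u : α} (hu : u ∈ S) :
    a u ≤ lpSum p S a := by
  rw [lpSum]
  split_ifs with htop
  · exact Finset.le_sup hu
  · have hpr : 0 < p.toReal := ENNReal.toReal_pos (zero_lt_one.trans_le hp).ne' htop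
    rw [one_div, ENNReal.le_rpow_inv_iff hpr]
    exact Finset.single_le_sum (f := fun u => a u ^ p.toReal) (fun _ _ => zero_le) hu

/-- Schur's test with respect to the `ℓ_p` norm. -/
theorem lpSum_le_of_le_sum {α : Type*} (hp : ENNReal.HolderConjugate p pstar) {S : Finset α}
    (r : α → α → Prop) [∀ v u, Decidable (r v u)] {a b : α → ℝ≥0∞} (M : ℝ≥0∞) {L : ℕ} (hL : 1 ≤ L)
    (ha : ∀ v ∈ S, a v ≤ M * ∑ u ∈ S with r v u, b u)
    (hcol : ∀ u ∈ S, (S.filter fun v => r v u).card ≤ L) :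
    lpSum p S a ≤ M * (S.card : ℝ≥0∞) ^ (1 / pstar).toReal * L * lpSum p S b := by
  have h1 := one_le_of_holderConjugate hp
  have hθ := toReal_inv_add hp
  have hL' : (1 : ℝ≥0∞) ≤ L := by exact_mod_cast hL
  rcases eq_or_ne p ∞ with htop | htop
  -- At `p = ∞` the exponent `1/p*` is 1 and the row count alone suffices; the factor `L ≥ 1` is
  -- slack.
  · simp only [htop, ENNReal.inv_top, ENNReal.toReal_zero, zero_add] at hθ
    simp only [lpSum, htop, if_true, hθ, ENNReal.rpow_one]
    refine Finset.sup_le fun v hv => (ha v hv).trans ?_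
    have : ∑ u ∈ S with r v u, b u ≤ S.card * S.sup b := by
      refine (Finset.sum_le_card_nsmul _ _ (S.sup b) fun u hu =>
        Finset.le_sup (Finset.mem_filter.1 hu).1).trans ?_
      rw [nsmul_eq_mul]
      gcongr
      exact Finset.filter_subset _ _
    calc M * ∑ u ∈ S with r v u, b u ≤ M * (S.card * S.sup b) := by gcongr
      _ = M * S.card * 1 * S.sup b := by ring
      _ ≤ _ := by gcongr
  · set P := p.toReal with hP
    have hP1 : 1 ≤ P := by
      rw [hP, ← ENNReal.toReal_one]
      exact ENNReal.toReal_mono htop h1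
    have hP0 : 0 < P := zero_lt_one.trans_le hP1
    rw [ENNReal.toReal_inv, ← hP] at hθ
    simp only [lpSum, htop, if_false, ← hP]
    -- Hölder on a single row, with the number of its entries bounded crudely by `S.card`.
    have hv : ∀ v ∈ S, a v ^ P ≤
        M ^ P * (S.card : ℝ≥0∞) ^ (P - 1) * ∑ u ∈ S with r v u, b u ^ P := by
      intro v hv
      calc a v ^ P ≤ (M * ∑ u ∈ S with r v u, b u) ^ P := ENNReal.rpow_le_rpow (ha v hv) hP0.le
        _ = M ^ P * (∑ u ∈ S with r v u, b u) ^ P := ENNReal.mul_rpow_of_nonneg _ _ hP0.le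
        _ ≤ M ^ P * (((S.filter fun u => r v u).card : ℝ≥0∞) ^ (P - 1) *
              ∑ u ∈ S with r v u, b u ^ P) := by
            gcongr
            exact ENNReal.rpow_sum_le_const_mul_sum_rpow _ _ hP1
        _ ≤ M ^ P * ((S.card : ℝ≥0∞) ^ (P - 1) * ∑ u ∈ S with r v u, b u ^ P) := by
            gcongr
            exact Finset.filter_subset _ _
        _ = _ := by ring
    have hsum : ∑ v ∈ S, a v ^ P ≤
        M ^ P * (S.card : ℝ≥0∞) ^ (P - 1) * (L * ∑ u ∈ S, b u ^ P) := by
      refine (Finset.sum_le_sum hv).trans ?_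
      rw [← Finset.mul_sum]
      gcongr
      -- After exchanging the sums, each `b u ^ P` is counted once per related `v`, hence at most
      -- `L` times.
      simp only [Finset.sum_filter]
      rw [Finset.sum_comm, Finset.mul_sum]
      refine Finset.sum_le_sum fun u hu => ?_
      rw [← Finset.sum_filter, Finset.sum_const, nsmul_eq_mul]
      gcongr
      exact hcol u hu
    calc (∑ v ∈ S, a v ^ P) ^ (1 / P)
        ≤ (M ^ P * (S.card : ℝ≥0∞) ^ (P - 1) * (L * ∑ u ∈ S, b u ^ P)) ^ (1 / P) :=
          ENNReal.rpow_le_rpow hsum (by positivity)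
      _ = M * (S.card : ℝ≥0∞) ^ (1 / pstar).toReal *
            ((L : ℝ≥0∞) ^ (1 / P) * (∑ u ∈ S, b u ^ P) ^ (1 / P)) := by
          have hi : 0 ≤ 1 / P := by positivity
          have he : (P - 1) * (1 / P) = (1 / pstar).toReal := by
            rw [eq_sub_of_add_eq' hθ]
            field_simp
          rw [ENNReal.mul_rpow_of_nonneg _ _ hi, ENNReal.mul_rpow_of_nonneg _ _ hi,
            ENNReal.mul_rpow_of_nonneg _ _ hi, ← ENNReal.rpow_mul, ← ENNReal.rpow_mul,
            mul_one_div_cancel hP0.ne', ENNReal.rpow_one, he]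
      _ ≤ M * (S.card : ℝ≥0∞) ^ (1 / pstar).toReal * (L * (∑ u ∈ S, b u ^ P) ^ (1 / P)) := by
          gcongr
          calc (L : ℝ≥0∞) ^ (1 / P) ≤ (L : ℝ≥0∞) ^ (1 : ℝ) :=
                ENNReal.rpow_le_rpow_of_exponent_le hL' ((div_le_one hP0).2 hP1)
            _ = L := ENNReal.rpow_one _
      _ = _ := by ring

end LpSum

/-! ### Combinatorics of sets of bounded diameter -/

section Diameter

variable {s q : ℕ} {ω : ℝ}

theorem diam_le_iff {u : Finset (Fin s)} :
    diam u ≤ q ↔ ∀ i ∈ u, ∀ j ∈ u, (j : ℕ) ≤ i + q := by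
  simp only [diam, Finset.sup_le_iff]
  constructor
  · intro h i hi j hj
    have := h i hi j hj
    omega
  · intro h i hi j hj
    have := h i hi j hj
    have := h j hj i hi
    omega

theorem mem_activeSets_finiteDiameterWeight (hω : 0 < ω) {u : Finset (Fin s)} :
    u ∈ activeSets (finiteDiameterWeight s ω q) ↔ diam u ≤ q := by
  simp only [activeSets, Finset.mem_filter, Finset.mem_univ, true_and]
  rw [finiteDiameterWeight]
  split_ifs with h
  · simp [h, pow_pos hω]
  · simp [h]

theorem diam_mono {u v : Finset (Fin s)} (hvu : v ⊆ u) (hu : diam u ≤ q) : diam v ≤ q :=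
  diam_le_iff.2 fun i hi j hj => diam_le_iff.1 hu i (hvu hi) j (hvu hj)

theorem diam_le_of_card_eq_one {u : Finset (Fin s)} (hu : u.card = 1) : diam u ≤ q := by
  obtain ⟨i, rfl⟩ := Finset.card_eq_one.1 hu
  simp [diam]

/-- The coordinates `i, …, i + q`. -/
def window (q : ℕ) (i : Fin s) : Finset (Fin s) := {j | i ≤ j ∧ (j : ℕ) ≤ i + q}

theorem card_window_le (i : Fin s) : (window q i).card ≤ q + 1 := by
  rw [← Finset.card_map Fin.valEmbedding]
  refine (Finset.card_le_card (t := Finset.Icc (i : ℕ) (i + q)) fun k hk => ?_).trans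
    (by rw [Nat.card_Icc]; omega)
  obtain ⟨j, hj, rfl⟩ := Finset.mem_map.1 hk
  simp only [window, Finset.mem_filter, Finset.mem_univ, true_and] at hj
  exact Finset.mem_Icc.2 ⟨hj.1, hj.2⟩

theorem exists_subset_window {u : Finset (Fin s)} (hu : u.Nonempty) (hd : diam u ≤ q) :
    ∃ i, u ⊆ window q i :=
  ⟨u.min' hu, fun j hj => by
    simp only [window, Finset.mem_filter, Finset.mem_univ, true_and]
    exact ⟨u.min'_le j hj, diam_le_iff.1 hd _ (u.min'_mem hu) j hj⟩⟩

theorem card_le_of_diam_le {u : Finset (Fin s)} (hd : diam u ≤ q) : u.card ≤ q + 1 := by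
  rcases u.eq_empty_or_nonempty with rfl | hu
  · simp
  · obtain ⟨i, hi⟩ := exists_subset_window hu hd
    exact (Finset.card_le_card hi).trans (card_window_le i)

/-- A nonempty active set lies in the window starting at its least element. There are `s` windows
with at most `2^(q+1)` subsets each, and the empty set adds one. -/
theorem card_activeSets_le (hω : 0 < ω) :
    (activeSets (finiteDiameterWeight s ω q)).card ≤ 1 + s * 2 ^ (q + 1) := by
  have hsub : activeSets (finiteDiameterWeight s ω q) ⊆
      {∅} ∪ Finset.univ.biUnion fun i : Fin s => (window q i).powerset := by
    intro u hu
    rw [mem_activeSets_finiteDiameterWeight hω] at hu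
    rcases u.eq_empty_or_nonempty with rfl | hne
    · simp
    · obtain ⟨i, hi⟩ := exists_subset_window hne hu
      exact Finset.mem_union_right _
        (Finset.mem_biUnion.2 ⟨i, Finset.mem_univ _, Finset.mem_powerset.2 hi⟩)
  refine (Finset.card_le_card hsub).trans ((Finset.card_union_le _ _).trans ?_)
  rw [Finset.card_singleton]
  gcongr
  refine (Finset.card_biUnion_le_card_mul _ _ (2 ^ (q + 1)) fun i _ => ?_).trans (by simp)
  rw [Finset.card_powerset]
  exact Nat.pow_le_pow_right two_pos (card_window_le i)

theorem card_activeSets_le_mul_sub (hω : 0 < ω) (hqs : q < s) :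
    ((activeSets (finiteDiameterWeight s ω q)).card : ℝ) ≤
      2 ^ (q + 2) * (q + 1) * ((s : ℝ) - q) := by
  have h : ((activeSets (finiteDiameterWeight s ω q)).card : ℝ) ≤ 1 + s * 2 ^ (q + 1) := by
    exact_mod_cast card_activeSets_le (s := s) (q := q) hω
  have hs : (q : ℝ) + 1 ≤ s := by exact_mod_cast hqs
  have hq : (0 : ℝ) ≤ q := q.cast_nonneg
  -- The difference of the two sides is `q (s - q - 1)`, nonnegative because `s ≥ q + 1`.
  have h1 : (s : ℝ) ≤ (q + 1) * ((s : ℝ) - q) := by nlinarith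
  have h2 : (1 : ℝ) ≤ s * 2 ^ (q + 1) :=
    one_le_mul_of_one_le_of_one_le (by linarith) (one_le_pow₀ one_le_two)
  calc _ ≤ (1 : ℝ) + s * 2 ^ (q + 1) := h
    _ ≤ 2 ^ (q + 2) * (s : ℝ) := by rw [pow_succ 2 (q + 1)]; linarith
    _ ≤ 2 ^ (q + 2) * ((q + 1) * ((s : ℝ) - q)) := by gcongr
    _ = _ := by ring

/-- The ratio of the weights is `ω^(|w| - |v|)` with exponent between 0 and `q + 1`; the maximum
with 1 covers `ω < 1`. -/
theorem inv_finiteDiameterWeight_le (hω : 0 < ω) {v w : Finset (Fin s)} (hvw : v ⊆ w)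
    (hw : diam w ≤ q) :
    (finiteDiameterWeight s ω q v)⁻¹ ≤
      max 1 ω ^ (q + 1) * (finiteDiameterWeight s ω q w)⁻¹ := by
  have hcard := Finset.card_le_card hvw
  simp only [finiteDiameterWeight, hw, diam_mono hvw hw, if_true]
  rw [← div_eq_mul_inv, le_div_iff₀ (pow_pos hω _), inv_mul_eq_div, div_le_iff₀ (pow_pos hω _)]
  calc ω ^ w.card = ω ^ (w.card - v.card) * ω ^ v.card := by
        rw [← pow_add, Nat.sub_add_cancel hcard]
    _ ≤ max 1 ω ^ (w.card - v.card) * ω ^ v.card := by gcongr; exact le_max_right _ _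
    _ ≤ max 1 ω ^ (q + 1) * ω ^ v.card := by
        gcongr
        · exact le_max_left _ _
        · exact (Nat.sub_le _ _).trans (card_le_of_diam_le hw)

end Diameter

/-! ### Upper and lower bounds for the embedding norm -/

section Bounds

variable {s q : ℕ} {ω : ℝ} {p pstar : ℝ≥0∞}

/-- The Schur-type bound for the inclusion relation `v ⊆ w`: the weight ratio gives the first
factor, the row size the second, and the number of subsets of an active set the last. -/
theorem embeddingNorm_le (hω : 0 < ω) (hp : ENNReal.HolderConjugate p pstar) :
    embeddingNorm s p (finiteDiameterWeight s ω q) ≤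
      ENNReal.ofReal (max 1 ω ^ (q + 1)) *
        ((activeSets (finiteDiameterWeight s ω q)).card : ℝ≥0∞) ^ (1 / pstar).toReal *
        (2 ^ (q + 1) : ℕ) := by
  have h1 := one_le_of_holderConjugate hp
  refine sInf_le fun f hf => ?_
  obtain ⟨h, hmem, heq⟩ := hf
  have hrep : IsAnchoredRep p (activeSets (finiteDiameterWeight s ω q)) f h := ⟨hmem, heq⟩
  refine ⟨hrep.mem_anova h1 fun u hu v hvu => ?_, ?_⟩
  · rw [mem_activeSets_finiteDiameterWeight hω] at hu ⊢
    exact diam_mono hvu hu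
  · refine lpSum_le_of_le_sum hp (fun v w => v ⊆ w) _ Nat.one_le_two_pow (fun v _ => ?_)
      fun u hu => ?_
    · rw [Finset.mul_sum]
      refine (mul_le_mul_right (hrep.anovaPart_le h1 v) _).trans ?_
      rw [Finset.mul_sum]
      refine Finset.sum_le_sum fun w hw => ?_
      obtain ⟨hwS, hvw⟩ := Finset.mem_filter.1 hw
      rw [hrep.anchoredPart_eq h1 hwS, ← mul_assoc, ← ENNReal.ofReal_mul (by positivity)]
      gcongr
      exact inv_finiteDiameterWeight_le hω hvw
        ((mem_activeSets_finiteDiameterWeight hω).1 hwS)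
    · rw [mem_activeSets_finiteDiameterWeight hω] at hu
      calc _ ≤ u.powerset.card := Finset.card_le_card fun v hv =>
            Finset.mem_powerset.2 (Finset.mem_filter.1 hv).2
        _ = 2 ^ u.card := Finset.card_powerset u
        _ ≤ 2 ^ (q + 1) := Nat.pow_le_pow_right two_pos (card_le_of_diam_le hu)

theorem integral_eval_cubeMeasure {ι : Type*} [Fintype ι] (i : ι) {g : ℝ → ℝ} (hg : Measurable g) :
    ∫ x, g (x i) ∂cubeMeasure ι = ∫ r in Set.Icc (0 : ℝ) 1, g r := by
  have hmp : MeasurePreserving (Function.eval i) (cubeMeasure ι)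
      ((volume : Measure ℝ).restrict (Set.Icc 0 1)) := by
    rw [cubeMeasure_eq_pi]
    exact measurePreserving_eval _ i
  exact integral_comp_of_measurePreserving hmp hg.aestronglyMeasurable

theorem integral_indKernel {x : ℝ} (hx : x ∈ Set.Icc (0 : ℝ) 1) :
    ∫ t in Set.Icc (0 : ℝ) 1, indKernel x t = x := by
  have h : Set.Icc (0 : ℝ) 1 ∩ Set.Ico 0 x = Set.Ico 0 x :=
    Set.inter_eq_right.2 fun t ht => ⟨ht.1, ht.2.le.trans hx.2⟩
  simp only [indKernel]
  rw [setIntegral_indicator measurableSet_Ico, h]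
  simp [hx.1]

/-- The coefficients of `x ↦ ∑ i, x i` in the anchored representation. -/
noncomputable def linearCoeff (u : Finset (Fin s)) (_ : ↥u → ℝ) : ℝ := if u.card = 1 then 1 else 0

theorem memLp_linearCoeff (u : Finset (Fin s)) : MemLp (linearCoeff u) p (cubeMeasure ↥u) :=
  memLp_const _

theorem integral_anchoredTerm_linearCoeff (u : Finset (Fin s)) :
    ∫ x, anchoredTerm u (linearCoeff u) x ∂cubeMeasure (Fin s) =
      if u.card = 1 then 1 / 2 else 0 := by
  split_ifs with hu
  · obtain ⟨i, rfl⟩ := Finset.card_eq_one.1 hu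
    have h : ∀ᵐ x ∂cubeMeasure (Fin s), anchoredTerm {i} (linearCoeff {i}) x = x i := by
      filter_upwards [ae_mem_cube] with x hx
      rw [anchoredTerm_eq_mixedAnchored (memLp_linearCoeff (p := 1) _).1, mixedAnchored_empty]
      simp only [extend, linearCoeff, Finset.card_singleton, if_true, one_mul,
        Finset.prod_singleton]
      rw [integral_eval_cubeMeasure i (measurable_indKernel_right (x i)),
        integral_indKernel (hx i trivial)]
    rw [integral_congr_ae h, integral_eval_cubeMeasure i (g := fun r => r) measurable_id,
      integral_Icc_eq_integral_Ioc, ← intervalIntegral.integral_of_le zero_le_one]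
    simp
  · simp [anchoredTerm, linearCoeff, hu]

theorem isMixedDeriv_empty {ι : Type*} [Fintype ι] [LinearOrder ι] {f : (ι → ℝ) → ℝ}
    (hf : Integrable f (cubeMeasure ι)) : IsMixedDeriv ∅ f f :=
  ⟨hf, hf, fun φ _ _ _ => by simp [mixedPartial]⟩

/-- With no derivative to take, `f` is its own derivative, and the part at `∅` is the L_p norm of a
mean over all coordinates. -/
theorem enorm_integral_le_anovaPart_empty (hp : 1 ≤ p) {f : (Fin s → ℝ) → ℝ}
    (hf : Integrable f (cubeMeasure (Fin s))) :
    ‖∫ x, f x ∂cubeMeasure (Fin s)‖ₑ ≤ anovaPart p ∅ f := by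
  refine le_iInf₂ fun G hG => ?_
  have hae := hG.ae_eq (isMixedDeriv_empty hf)
  have havg := memLp_average le_rfl ∅ (memLp_one_iff_integrable.2 hG.integrable_deriv)
  have hint := integral_average_mul ∅ hG.integrable_deriv (k := fun _ _ => 1)
    (fun _ => measurable_const) (by simp)
  simp only [Finset.prod_const_one, mul_one] at hint
  rw [← integral_congr_ae hae, ← hint]
  calc _ ≤ eLpNorm (average ∅ G) 1 (cubeMeasure _) := by
        rw [eLpNorm_one_eq_lintegral_enorm]
        exact enorm_integral_le_lintegral_enorm _
    _ ≤ _ := eLpNorm_le_eLpNorm_of_exponent_le hp havg.1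

theorem card_filter_card_eq_one (hω : 0 < ω) :
    ((activeSets (finiteDiameterWeight s ω q)).filter fun u => u.card = 1).card = s := by
  have : ((activeSets (finiteDiameterWeight s ω q)).filter fun u => u.card = 1) =
      Finset.powersetCard 1 Finset.univ := by
    ext u
    simp only [Finset.mem_filter, mem_activeSets_finiteDiameterWeight hω, Finset.mem_powersetCard,
      Finset.subset_univ, true_and]
    exact ⟨fun h => h.2, fun h => ⟨diam_le_of_card_eq_one h, h⟩⟩
  rw [this, Finset.card_powersetCard]
  simp

/-- The function `x ↦ ∑ i, x i`, as an element of the anchored space. -/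
noncomputable def linearFun (s : ℕ) (ω : ℝ) (q : ℕ) (x : Fin s → ℝ) : ℝ :=
  ∑ u ∈ activeSets (finiteDiameterWeight s ω q), anchoredTerm u (linearCoeff u) x

theorem isAnchoredRep_linearFun : IsAnchoredRep p (activeSets (finiteDiameterWeight s ω q))
    (linearFun s ω q) linearCoeff :=
  ⟨fun u _ => memLp_linearCoeff u, fun _ _ => rfl⟩

theorem ofReal_le_anovaNorm_linearFun (hω : 0 < ω) (hp : 1 ≤ p) :
    ENNReal.ofReal (s / 2) ≤ anovaNorm p (finiteDiameterWeight s ω q) (linearFun s ω q) := by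
  have hint : ∀ u ∈ activeSets (finiteDiameterWeight s ω q),
      Integrable (anchoredTerm u (linearCoeff u)) (cubeMeasure (Fin s)) := fun u _ => by
    rw [funext (anchoredTerm_eq_mixedAnchored (memLp_linearCoeff (p := 1) u).1)]
    exact integrable_mixedAnchored ((memLp_extend (memLp_linearCoeff u)).integrable le_rfl) _ _
  have hval : ∫ x, linearFun s ω q x ∂cubeMeasure (Fin s) = s / 2 := by
    simp only [linearFun]
    rw [integral_finsetSum _ hint,
      Finset.sum_congr rfl fun u _ => integral_anchoredTerm_linearCoeff u, ← Finset.sum_filter,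
      Finset.sum_const, card_filter_card_eq_one hω, nsmul_eq_mul]
    ring
  have hempty : (∅ : Finset (Fin s)) ∈ activeSets (finiteDiameterWeight s ω q) := by
    rw [mem_activeSets_finiteDiameterWeight hω]
    simp [diam]
  refine le_trans ?_ (le_lpSum hp _ hempty)
  have hw : finiteDiameterWeight s ω q ∅ = 1 := by simp [finiteDiameterWeight, diam]
  rw [hw, inv_one, ENNReal.ofReal_one, one_mul]
  refine le_trans ?_ (enorm_integral_le_anovaPart_empty hp (integrable_finsetSum _ hint))
  rw [hval, Real.enorm_of_nonneg (by positivity)]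

theorem anchoredNorm_linearFun_le (hω : 0 < ω) (hp : 1 ≤ p) :
    anchoredNorm p (finiteDiameterWeight s ω q) (linearFun s ω q) ≤
      ENNReal.ofReal ω⁻¹ * (s : ℝ≥0∞) ^ p⁻¹.toReal := by
  have hp0 : p ≠ 0 := (zero_lt_one.trans_le hp).ne'
  have hterm : ∀ u ∈ activeSets (finiteDiameterWeight s ω q),
      ENNReal.ofReal (finiteDiameterWeight s ω q u)⁻¹ * anchoredPart p u (linearFun s ω q) =
        if u.card = 1 then ENNReal.ofReal ω⁻¹ else 0 := by
    intro u hu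
    rw [isAnchoredRep_linearFun.anchoredPart_eq hp hu]
    have hn : eLpNorm (linearCoeff u) p (cubeMeasure ↥u) = if u.card = 1 then 1 else 0 := by
      have := eLpNorm_const (μ := cubeMeasure ↥u) (if u.card = 1 then (1 : ℝ) else 0) hp0
        (IsProbabilityMeasure.ne_zero _)
      rw [measure_univ, ENNReal.one_rpow, mul_one] at this
      refine this.trans ?_
      split_ifs <;> simp
    rw [hn]
    split_ifs with h
    · rw [mul_one, finiteDiameterWeight, if_pos (diam_le_of_card_eq_one h), h, pow_one]
    · simp
  rw [anchoredNorm, lpSum]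
  split_ifs with htop
  · refine Finset.sup_le fun u hu => ?_
    rw [hterm u hu]
    split_ifs <;> simp [htop]
  · have hpr : 0 < p.toReal := ENNReal.toReal_pos hp0 htop
    rw [Finset.sum_congr rfl fun u hu => by rw [hterm u hu]]
    have hite : ∀ u : Finset (Fin s), (if u.card = 1 then ENNReal.ofReal ω⁻¹ else 0) ^ p.toReal =
        if u.card = 1 then ENNReal.ofReal ω⁻¹ ^ p.toReal else 0 := fun u => by
      split_ifs
      · rfl
      · exact ENNReal.zero_rpow_of_pos hpr
    simp only [hite]
    rw [← Finset.sum_filter, Finset.sum_const, card_filter_card_eq_one hω, nsmul_eq_mul,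
      ENNReal.mul_rpow_of_nonneg _ _ (by positivity), ← ENNReal.rpow_mul,
      mul_one_div_cancel hpr.ne', ENNReal.rpow_one, mul_comm, ENNReal.toReal_inv, one_div]

/-- The quotient of the two norms of `∑ x_i` is at least `(s/2) / (ω⁻¹ s^{1/p})`, which equals
`(ω/2) s^{1/p*}` by conjugacy of the exponents. -/
theorem le_embeddingNorm (hω : 0 < ω) (hp : ENNReal.HolderConjugate p pstar) (hs : 0 < s) :
    ENNReal.ofReal (ω / 2 * (s : ℝ) ^ (1 / pstar).toReal) ≤
      embeddingNorm s p (finiteDiameterWeight s ω q) := by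
  have h1 := one_le_of_holderConjugate hp
  have hθ := toReal_inv_add hp
  have hs' : (0 : ℝ) < s := by exact_mod_cast hs
  refine le_sInf fun C hC => ?_
  obtain ⟨-, hC⟩ := hC (linearFun s ω q)
    ⟨linearCoeff, fun u _ => memLp_linearCoeff u, fun _ _ => rfl⟩
  have hD : ENNReal.ofReal ω⁻¹ * (s : ℝ≥0∞) ^ p⁻¹.toReal =
      ENNReal.ofReal (ω⁻¹ * (s : ℝ) ^ p⁻¹.toReal) := by
    rw [ENNReal.ofReal_mul (by positivity), ← ENNReal.ofReal_rpow_of_pos hs',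
      ENNReal.ofReal_natCast]
  have hD0 : 0 < ω⁻¹ * (s : ℝ) ^ p⁻¹.toReal := by positivity
  have key : ENNReal.ofReal (s / 2) ≤ C * ENNReal.ofReal (ω⁻¹ * (s : ℝ) ^ p⁻¹.toReal) := by
    rw [← hD]
    exact (ofReal_le_anovaNorm_linearFun hω h1).trans
      (hC.trans (mul_le_mul_right (anchoredNorm_linearFun_le hω h1) C))
  have hsplit : (s : ℝ) / 2 =
      ω / 2 * (s : ℝ) ^ (1 / pstar).toReal * (ω⁻¹ * (s : ℝ) ^ p⁻¹.toReal) := by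
    have : (s : ℝ) ^ p⁻¹.toReal * (s : ℝ) ^ (1 / pstar).toReal = s := by
      rw [← Real.rpow_add hs', hθ, Real.rpow_one]
    field_simp
    linarith
  rw [hsplit, ENNReal.ofReal_mul (by positivity)] at key
  exact (ENNReal.mul_le_mul_iff_left (ENNReal.ofReal_pos.2 hD0).ne' ENNReal.ofReal_ne_top).1 key

end Bounds

end AnchoredANOVA

theorem mainTheorem3 (ω : ℝ) (hω : 0 < ω) (q : ℕ) (p pstar : ℝ≥0∞)
    (hp : ENNReal.HolderConjugate p pstar) :
    ∃ c C : ℝ, 0 < c ∧ 0 < C ∧ ∀ s : ℕ, q < s →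
      ENNReal.ofReal (c * ((s : ℝ) - (q : ℝ)) ^ (1 / pstar).toReal) ≤
        AnchoredANOVA.embeddingNorm s p (AnchoredANOVA.finiteDiameterWeight s ω q) ∧
      AnchoredANOVA.embeddingNorm s p (AnchoredANOVA.finiteDiameterWeight s ω q) ≤
        ENNReal.ofReal (C * ((s : ℝ) - (q : ℝ)) ^ (1 / pstar).toReal) := by
  have hm : 0 < max 1 ω := lt_max_of_lt_left one_pos
  -- The upper constant collects the weight ratio, the factor in the count of active sets raised to
  -- `1/p*`, and the number of subsets of an active set.
  refine ⟨ω / 2, max 1 ω ^ (q + 1) * (2 ^ (q + 2) * (q + 1)) ^ (1 / pstar).toReal * 2 ^ (q + 1),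
    by positivity, by positivity, fun s hqs => ⟨?_, ?_⟩⟩
  · have hsq : (q : ℝ) < s := by exact_mod_cast hqs
    refine le_trans (ENNReal.ofReal_le_ofReal ?_)
      (AnchoredANOVA.le_embeddingNorm hω hp (Nat.zero_lt_of_lt hqs))
    have h0 : (0 : ℝ) ≤ (s : ℝ) - q := by linarith
    -- The lower bound is available with `s` itself, which only exceeds `s - q`.
    have h1 : (s : ℝ) - q ≤ s := by linarith [(q.cast_nonneg : (0 : ℝ) ≤ q)]
    gcongr
  · have hsq : (0 : ℝ) < (s : ℝ) - q := sub_pos.2 (by exact_mod_cast hqs)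
    refine (AnchoredANOVA.embeddingNorm_le hω hp).trans ?_
    have hcard := AnchoredANOVA.card_activeSets_le_mul_sub hω hqs
    have hrw : ∀ n m : ℕ, ENNReal.ofReal (max 1 ω ^ (q + 1)) *
        (n : ℝ≥0∞) ^ (1 / pstar).toReal * (m : ℝ≥0∞) =
        ENNReal.ofReal (max 1 ω ^ (q + 1) * (n : ℝ) ^ (1 / pstar).toReal * m) := fun n m => by
      rw [ENNReal.ofReal_mul (by positivity), ENNReal.ofReal_mul (by positivity),
        ← ENNReal.ofReal_rpow_of_nonneg n.cast_nonneg ENNReal.toReal_nonneg,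
        ENNReal.ofReal_natCast, ENNReal.ofReal_natCast]
    rw [hrw]
    refine ENNReal.ofReal_le_ofReal ?_
    calc _ ≤ max 1 ω ^ (q + 1) *
          (2 ^ (q + 2) * (q + 1) * ((s : ℝ) - q)) ^ (1 / pstar).toReal * 2 ^ (q + 1) := by
          push_cast
          gcongr
      _ = _ := by
          rw [Real.mul_rpow (by positivity) hsq.le]
          ring
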